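/- **Setting.** Write $\mathbf u\otimes\mathbf v=\mathbf u\mathbf v^T$. Let $a,b,c,d>0$ be such that the twelve matrices $$U_{1,2}=\begin{pmatrix}a&\pm b&0\\ \pm b&c&0\\ 0&0&d\end{pmatrix},\quad U_{3,4}=\begin{pmatrix}c&\pm b&0\\ \pm b&a&0\\ 0&0&d\end{pmatrix},\quad U_{5,6}=\begin{pmatrix}a&0&\pm b\\ 0&d&0\\ \pm b&0&c\end{pmatrix},\quad U_{7,8}=\begin{pmatrix}c&0&\pm b\\ 0&d&0\\ \pm b&0&a\end{pmatrix},$$ $$U_{9,10}=\begin{pmatrix}d&0&0\\ 0&a&\pm b\\ 0&\pm b&c\end{pmatrix},\quad U_{11,12}=\begin{pmatrix}d&0&0\\ 0&c&\pm b\\ 0&\pm b&a\end{pmatrix}$$ (upper sign for the first index) are positive definite, and let $\mathcal M=\{U_1,\dots,U_{12}\}$. *Type I twins.* Let $U\ne V$ be symmetric positive definite, and suppose that there is, uniquely up to sign, a unit vector $\hat{\mathbf e}$ with $V=(-1+2\hat{\mathbf e}\otimes\hat{\mathbf e})\,U\,(-1+2\hat{\mathbf e}\otimes\hat{\mathbf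 e})$. Put $\mathbf m=\hat{\mathbf e}$ and $\mathbf b=2\bigl(U^{-1}\hat{\mathbf e}/|U^{-1}\hat{\mathbf e}|^2-U\hat{\mathbf e}\bigr)$, and let $R\in SO(3)$ satisfy $RV-U=\mathbf b\otimes\mathbf m$. Then $(U,\mathbf b,\mathbf m)$ is the type I twin generated by $(U,V)$. It satisfies the *cofactor conditions* if the middle eigenvalue of $U$ is $1$, $\mathbf b\cdot U\operatorname{cof}(U^2-1)\mathbf m=0$, and $\operatorname{tr}U^2-\det U^2-\frac14|\mathbf b|^2|\mathbf m|^2-2\ge0$. *Star twins.* Suppose that the type I twin generated by $(U,V)$, $U,V\in\mathcal M$, satisfies the cofactor conditions. Let $R_U,R_V\in SO(3)$, $\mathbf a\in\mathbb R^3$ and unit vectors $\mathbf n_U,\mathbf n_V$ be such that $R_UU=1+\mathbf a\otimes\mathbf n_U$, $R_VV=1+\mathbf a\otimes\mathbf n_V$, $R_U\mathbf b\times\mathbf a=0$, $(\mathbf n_U\times\mathbf n_V)\cdot\mathbf m=0$, $R_V=R_UR$. The twin is a *type I star twin* if (for such $R_U,R_V,\mathbf a,\mathbf n_U,\mathbf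 n_V$) there are $\mu\in(0,1)$ and three different rotations $Q_1,Q_2,Q_3\in SO(3)\setminus\{1\}$ such that, with $\mathbf n=\mu\mathbf n_U+(1-\mu)\mathbf n_V$, 1. $Q_iUQ_i^T,\;Q_iVQ_i^T\in\mathcal M$ for all $i$; 2. $Q_i\mathbf n=\chi_i\mathbf n$ with $\chi_i\in\{1,-1\}$ for all $i$; 3. $(Q_i\mathbf a\times Q_j\mathbf a)\cdot\mathbf a\ne0$ for all $i\ne j$, and $(Q_1\mathbf a\times Q_2\mathbf a)\cdot Q_3\mathbf a\neq0$. It is a *type I half-star twin* if there are two such rotations (for two rotations, 3 reads $(Q_1\mathbf a\times Q_2\mathbf a)\cdot\mathbf a\neq0$) but not three, i.e. it is not a star twin. **Theorem.** Let $i\ne j$, suppose that $U_i,U_j$ generate a type I twin satisfying the cofactor conditions, and let $\lambda_1\le\lambda_2=1\le\lambda_3$ be the eigenvalues of $U_1$. The twin is a type I half-star twin if and only if one of the following holds: - $d\ne1$, $d=\lambda_1$ and $4(2d^2\lambda_3^2-\lambda_3^2-d^2)=(d-\lambda_3)^2(1-d^2)$; - $d\ne1$, $d=\lambda_3$, $(d,\lambda_1)\neq(\sqrt5,1/\sqrt5)$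 and $4(2d^2\lambda_1^2-\lambda_1^2-d^2)=(d-\lambda_1)^2(1-d^2)$; - $d=1$, $\lambda_3>1$ and $\lambda_1^2(5\lambda_3^2-1)=8\lambda_1\lambda_3-5+\lambda_3^2$. The twin is a type I star twin if and only if $a\ne c$ and one of the following holds: - $d\ne1$, $d=\lambda_1$ and $2d^2\lambda_3^2-\lambda_3^2-d^2=(d-\lambda_3)^2(1-d^2)$; - $d\ne1$, $d=\lambda_3$ and $2d^2\lambda_1^2-\lambda_1^2-d^2=(d-\lambda_1)^2(1-d^2)$. -/

import Mathlib

open scoped Matrix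

/-- Real `3 × 3` matrices. -/
abbrev Mat3 : Type := Matrix (Fin 3) (Fin 3) ℝ

/-- Vectors of `ℝ³`; lengths are expressed through the dot product `v ⬝ᵥ v`. -/
abbrev Vec3 : Type := Fin 3 → ℝ

/-- The tensor product `u ⊗ v`, that is the matrix with entries `u i * v j`. -/
def tensor (u v : Vec3) : Mat3 := Matrix.vecMulVec u v

/-- `v` lies on the unit sphere. -/
def IsUnitVec (v : Vec3) : Prop := v ⬝ᵥ v = 1

/-- The group of rotations, as a set of matrices. -/
def IsRotation (R : Mat3) : Prop := R ∈ Matrix.specialOrthogonalGroup (Fin 3) ℝ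

/-- The cofactor matrix, the transpose of the adjugate. -/
def cofactorMatrix (A : Mat3) : Mat3 := A.adjugateᵀ

/-- The rotation by `π` about the axis `e` (for `e` a unit vector). -/
def halfTurn (e : Vec3) : Mat3 := -1 + (2 : ℝ) • tensor e e

/-- `e` is a unit vector such that `U` and `V` are related by the rotation by `π` about `e`. -/
def IsTwinAxis (U V : Mat3) (e : Vec3) : Prop :=
  IsUnitVec e ∧ V = halfTurn e * U * halfTurn e

/-- `l₁ ≤ l₂ ≤ l₃` are the eigenvalues of `U`, counted with multiplicity. -/
def IsOrderedSpectrum (U : Mat3) (l₁ l₂ l₃ : ℝ) : Prop :=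
  l₁ ≤ l₂ ∧ l₂ ≤ l₃ ∧
    U.charpoly = (Polynomial.X - Polynomial.C l₁) * (Polynomial.X - Polynomial.C l₂) *
      (Polynomial.X - Polynomial.C l₃)

/-- `(R, b, m)` is a type I solution of the twinning equation `R V - U = b ⊗ m` for the distinct
symmetric positive definite matrices `U`, `V`, and `(U, b, m)` is a type I twin: the twin axis is
unique up to sign (so that the twin is not compound), `m` is the twin axis, and
`b = 2 (U⁻¹ m / |U⁻¹ m|² - U m)`. -/
structure IsTypeITwin (U V R : Mat3) (b m : Vec3) : Prop where
  posDef_left : U.PosDef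
  posDef_right : V.PosDef
  ne : U ≠ V
  axis : IsTwinAxis U V m
  axis_unique : ∀ e : Vec3, IsTwinAxis U V e → e = m ∨ e = -m
  shear : b = (2 : ℝ) •
    (((U⁻¹ *ᵥ m) ⬝ᵥ (U⁻¹ *ᵥ m))⁻¹ • (U⁻¹ *ᵥ m) - U *ᵥ m)
  rotation : IsRotation R
  twinning : R * V - U = tensor b m

/-- The cofactor conditions for `(U, b, m)`. -/
structure CofactorConditions (U : Mat3) (b m : Vec3) : Prop where
  cc1 : ∃ l₁ l₃ : ℝ, IsOrderedSpectrum U l₁ 1 l₃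
  cc2 : b ⬝ᵥ ((U * cofactorMatrix (U ^ 2 - 1)) *ᵥ m) = 0
  cc3 : 0 ≤ (U ^ 2).trace - (U ^ 2).det - (1 / 4) * (b ⬝ᵥ b) * (m ⬝ᵥ m) - 2

/-- The two exactly compatible interfaces with austenite of a type I twin `(R, b, m)` generated by
`U`, `V`: rotations `RU`, `RV = RU R` with `RU U = 1 + a ⊗ nU`, `RV V = 1 + a ⊗ nV`, the shear
vector `a` being common to both and parallel to `RU b`, and `nU`, `nV`, `m` being coplanar.
For a given twin these conditions determine `(a, nU, nV)` up to a common sign. -/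
structure TypeIInterfaces (U V R : Mat3) (b m : Vec3) (RU RV : Mat3) (a nU nV : Vec3) :
    Prop where
  rotation_left : IsRotation RU
  rotation_right : IsRotation RV
  unit_left : IsUnitVec nU
  unit_right : IsUnitVec nV
  interface_left : RU * U = 1 + tensor a nU
  interface_right : RV * V = 1 + tensor a nV
  parallel : crossProduct (RU *ᵥ b) a = 0
  coplanar : (crossProduct nU nV) ⬝ᵥ m = 0
  compatible : RV = RU * R

/-- `Q` is a family of `k` different rotations, none of which is the identity, that map the pair
`U`, `V` into `M`, map `n = μ nU + (1 - μ) nV` to `± n`, and for which `a` and any two of the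
vectors `Q i a`, as well as any three of the vectors `Q i a`, are linearly independent. -/
structure IsStarFamily (M : Set Mat3) (U V : Mat3) (a nU nV : Vec3) (μ : ℝ) {k : ℕ}
    (Q : Fin k → Mat3) : Prop where
  injective : Function.Injective Q
  rotation : ∀ i, IsRotation (Q i)
  ne_one : ∀ i, Q i ≠ 1
  mem_left : ∀ i, Q i * U * (Q i)ᵀ ∈ M
  mem_right : ∀ i, Q i * V * (Q i)ᵀ ∈ M
  normal : ∀ i, ∃ χ : ℝ, (χ = 1 ∨ χ = -1) ∧
    Q i *ᵥ (μ • nU + (1 - μ) • nV) = χ • (μ • nU + (1 - μ) • nV)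
  indep : ∀ i j, i ≠ j → (crossProduct (Q i *ᵥ a) (Q j *ᵥ a)) ⬝ᵥ a ≠ 0
  indep_triple : ∀ i j l, i ≠ j → i ≠ l → j ≠ l →
    (crossProduct (Q i *ᵥ a) (Q j *ᵥ a)) ⬝ᵥ (Q l *ᵥ a) ≠ 0

/-- The type I twin `(U, b, m)` generated by `U, V ∈ M` satisfies the cofactor conditions and
admits, for some `μ ∈ (0, 1)`, a family of `k` rotations as above. -/
def HasStarFamily (k : ℕ) (M : Set Mat3) (U V R : Mat3) (b m : Vec3) : Prop :=
  U ∈ M ∧ V ∈ M ∧ IsTypeITwin U V R b m ∧ CofactorConditions U b m ∧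
    ∃ (RU RV : Mat3) (a nU nV : Vec3), TypeIInterfaces U V R b m RU RV a nU nV ∧
      ∃ μ : ℝ, 0 < μ ∧ μ < 1 ∧ ∃ Q : Fin k → Mat3, IsStarFamily M U V a nU nV μ Q

/-- `(U, b, m)` is a type I star twin generated by `(U, V)`: there are three such rotations. -/
def IsTypeIStarTwin (M : Set Mat3) (U V R : Mat3) (b m : Vec3) : Prop :=
  HasStarFamily 3 M U V R b m

/-- `(U, b, m)` is a type I half-star twin generated by `(U, V)`: there are two such rotations, and
not three. -/
def IsTypeIHalfStarTwin (M : Set Mat3) (U V R : Mat3) (b m : Vec3) : Prop :=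
  HasStarFamily 2 M U V R b m ∧ ¬ HasStarFamily 3 M U V R b m

/-- The twelve transformation matrices `U₁, …, U₁₂` of a cubic to monoclinic transformation with
the monoclinic axis along a `⟨1 0 0⟩` direction; `U₁` has index `0`. -/
def cubicMonoclinic (a b c d : ℝ) : Fin 12 → Mat3 :=
  ![!![a, b, 0; b, c, 0; 0, 0, d],
    !![a, -b, 0; -b, c, 0; 0, 0, d],
    !![c, b, 0; b, a, 0; 0, 0, d],
    !![c, -b, 0; -b, a, 0; 0, 0, d],
    !![a, 0, b; 0, d, 0; b, 0, c],
    !![a, 0, -b; 0, d, 0; -b, 0, c],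
    !![c, 0, b; 0, d, 0; b, 0, a],
    !![c, 0, -b; 0, d, 0; -b, 0, a],
    !![d, 0, 0; 0, a, b; 0, b, c],
    !![d, 0, 0; 0, a, -b; 0, -b, c],
    !![d, 0, 0; 0, c, b; 0, b, a],
    !![d, 0, 0; 0, c, -b; 0, -b, a]]

/-! The interfaces can be eliminated. Write `s` for the twin shear. A factorisation `U² = (1 + g ⊗
p)(1 + p ⊗ g)` with `s = 2 U p` determines them up to one common scalar: the shear is parallel to
`p` and the two normals to `g` and `g + 2 (det U) m` (`ShearData.interfaces_eq`,
`ShearData.exists_interfaces`). The star conditions are homogeneous, so only the lines of `p` and of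
`n(t) = g + 2t (det U) m`, `t = 1 - μ`, matter.

Uniqueness of the twin axis makes `d` a simple eigenvalue of every variant, so each variant
remembers its monoclinic axis. The axes of `U` and `V` are two different coordinate axes, and a
rotation taking both matrices into the set sends them to coordinate axes; hence it is one of the 24
cubic rotations (`isStarFamily_iff`). A cubic change of basis brings the twin axis to `(0, 1, 1)/√2`
up to sign (`exists_normal_form`).

In this frame the second cofactor condition forces `|U⁻¹ m| = 1`, and everything becomes explicit.
If `d ≠ 1`, the monoclinic block is `1 + κ (r, 1) ⊗ (r, 1)` with second eigenvalue `λ`; then `p` is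
parallel to `(r, 1, -1)`, `n(t)` to `(r, 1 - t(1+δ), δ - t(1+δ))` with `δ = d/λ`, and `r²` is a
rational function of `d`, `λ` (`shearData_of_ne_one`). If `d = 1`, `p` is parallel to `e₁` and
`n(t)` to `(ρ, 1 - t, -t)` (`shearData_of_eq_one`).

What remains is a finite question. Two different nontrivial cubic rotations preserve the line of `n`
only if it is of type ⟨1 0 0⟩, ⟨1 1 0⟩ or ⟨1 1 1⟩ (`isSpecialDirection_of_pair`), and `p ⬝ n = 0` is
impossible, since all images of `p` would lie in a plane. For `d ≠ 1`, type ⟨1 1 0⟩ means `r² =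
(1-δ)²` and yields three rotations, while type ⟨1 1 1⟩ means `4r² = (1-δ)²` and yields only two;
orthogonality excludes `r² = 1`, that is `a = c`, in the first case and `δ = 5`, the pair `(√5,
1/√5)`, in the second. For `d = 1` only ⟨1 1 1⟩ survives, with `t = 1/2` and `4ρ² = 1`. Substituting
`r²` and `ρ²` gives the stated equations. -/

/-! ### Rotations and rank-one matrices -/

lemma isRotation_iff {R : Mat3} : IsRotation R ↔ Rᵀ * R = 1 ∧ R * Rᵀ = 1 ∧ R.det = 1 := by
  unfold IsRotation
  rw [Matrix.mem_specialOrthogonalGroup_iff, Matrix.mem_orthogonalGroup_iff]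
  constructor
  · rintro ⟨h1, h2⟩
    have h1' : R * Rᵀ = 1 := h1
    exact ⟨mul_eq_one_comm.mp h1', h1', h2⟩
  · rintro ⟨h1, h2, h3⟩
    exact ⟨h2, h3⟩

lemma IsRotation.transpose {R : Mat3} (h : IsRotation R) : IsRotation Rᵀ := by
  rw [isRotation_iff] at *
  simp [h.1, h.2.1, h.2.2]

lemma IsRotation.mul {R S : Mat3} (h : IsRotation R) (h' : IsRotation S) : IsRotation (R * S) :=
  Submonoid.mul_mem _ h h'

lemma tensor_apply (u v : Vec3) (i j : Fin 3) : tensor u v i j = u i * v j := rfl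

lemma tensor_mulVec (u v w : Vec3) : tensor u v *ᵥ w = (v ⬝ᵥ w) • u := by
  simp [tensor, Matrix.vecMulVec_mulVec]

lemma mul_tensor (A : Mat3) (u v : Vec3) : A * tensor u v = tensor (A *ᵥ u) v := by
  simp [tensor, Matrix.mul_vecMulVec]

lemma tensor_mul (A : Mat3) (u v : Vec3) : tensor u v * A = tensor u (Aᵀ *ᵥ v) := by
  simp [tensor, Matrix.vecMulVec_mul, Matrix.mulVec_transpose]

lemma transpose_tensor (u v : Vec3) : (tensor u v)ᵀ = tensor v u := by
  ext i j; simp [tensor_apply, mul_comm]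

lemma smul_tensor (r : ℝ) (u v : Vec3) : tensor (r • u) v = r • tensor u v := by
  ext i j; simp [tensor_apply, mul_assoc]

lemma tensor_smul (r : ℝ) (u v : Vec3) : tensor u (r • v) = r • tensor u v := by
  ext i j; simp [tensor_apply, mul_left_comm]

lemma tensor_add (u v w : Vec3) : tensor u (v + w) = tensor u v + tensor u w := by
  ext i j; simp [tensor_apply, mul_add]

lemma det_one_add_tensor (u v : Vec3) : (1 + tensor u v).det = 1 + u ⬝ᵥ v := by
  simp [Matrix.det_fin_three, tensor_apply, dotProduct, Fin.sum_univ_three]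
  ring

lemma tensor_left_injective {p u v : Vec3} (hp : p ≠ 0) (h : tensor p u = tensor p v) : u = v := by
  obtain ⟨i, hi⟩ := Function.ne_iff.mp hp
  ext j
  have := congrFun (congrFun h i) j
  rw [tensor_apply, tensor_apply] at this
  exact mul_left_cancel₀ hi this

lemma dotProduct_self_pos {p : Vec3} (hp : p ≠ 0) : 0 < p ⬝ᵥ p := by
  have h := Matrix.dotProduct_star_self_pos_iff (v := p)
  simp only [star_trivial] at h
  exact h.mpr hp

lemma exists_smul_of_cross_eq_zero {p a : Vec3} (hp : p ≠ 0) (h : crossProduct p a = 0) :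
    ∃ κ : ℝ, a = κ • p := by
  have hpp := dotProduct_self_pos hp
  refine ⟨(p ⬝ᵥ a) / (p ⬝ᵥ p), ?_⟩
  have h0 := congrFun h 0
  have h1 := congrFun h 1
  have h2 := congrFun h 2
  simp [cross_apply] at h0 h1 h2
  ext i
  simp only [Pi.smul_apply, smul_eq_mul]
  rw [div_mul_eq_mul_div, eq_div_iff hpp.ne']
  simp only [dotProduct, Fin.sum_univ_three]
  fin_cases i <;> simp <;> grind

/-! ### Elimination of the interfaces -/

/-- The vectors `p`, `g` give the factorisation `U² = (1 + g ⊗ p)(1 + p ⊗ g)` attached to a type I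
twin `(U, s, m)`; up to a scalar they are the shear vector and the normal of its interfaces. -/
structure ShearData (U : Mat3) (s m p g : Vec3) : Prop where
  ne : p ≠ 0
  shear : s = (2 : ℝ) • (U *ᵥ p)
  gram : (1 + tensor g p) * (1 + tensor p g) = U * U
  dot : p ⬝ᵥ g = U.det - 1
  dot_axis : g ⬝ᵥ m = -U.det

lemma one_add_tensor_mulVec (u v w : Vec3) : (1 + tensor u v) *ᵥ w = w + (v ⬝ᵥ w) • u := by
  rw [Matrix.add_mulVec, Matrix.one_mulVec, tensor_mulVec]

lemma transpose_one_add_tensor (u v : Vec3) : (1 + tensor u v)ᵀ = 1 + tensor v u := by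
  rw [Matrix.transpose_add, Matrix.transpose_one, transpose_tensor]

lemma IsTypeITwin.transpose_left {U V R : Mat3} {s m : Vec3} (h : IsTypeITwin U V R s m) :
    Uᵀ = U := by
  have := h.posDef_left.isHermitian
  rwa [Matrix.IsHermitian, Matrix.conjTranspose_eq_transpose_of_trivial] at this

lemma ShearData.normal_ne {U : Mat3} {s m p g : Vec3} (hU : 0 < U.det)
    (hs : ShearData U s m p g) : g ≠ 0 := by
  rintro rfl
  have := hs.dot_axis
  simp at this
  exact hU.ne' this

/-- The parallelism condition forces `a = κ p`. Then `p` is an eigenvector of `RU U`, and evaluating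
`U²` at `p` through both factorisations identifies `κ nU` with `g`; the twinning equation gives
`nV`. -/
lemma ShearData.interfaces_eq {U V R : Mat3} {s m p g : Vec3} (h : IsTypeITwin U V R s m)
    (hs : ShearData U s m p g) {RU RV : Mat3} {a nU nV : Vec3}
    (hi : TypeIInterfaces U V R s m RU RV a nU nV) :
    ∃ κ : ℝ, κ ≠ 0 ∧ a = κ • p ∧ κ • nU = g ∧ κ • nV = g + (2 * U.det) • m := by
  have hD : 0 < U.det := h.posDef_left.det_pos
  obtain ⟨hR1, hR2, hR3⟩ := isRotation_iff.mp hi.rotation_left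
  have hF := hi.interface_left
  have hdetF : 1 + a ⬝ᵥ nU = U.det := by
    rw [← det_one_add_tensor, ← hF, Matrix.det_mul, hR3, one_mul]
  have hRs : RU *ᵥ s = (2 : ℝ) • (p + (nU ⬝ᵥ p) • a) := by
    rw [hs.shear, Matrix.mulVec_smul, Matrix.mulVec_mulVec, hF, one_add_tensor_mulVec]
  have hcross : crossProduct p a = 0 := by
    have h0 := hi.parallel
    rw [hRs] at h0
    simpa using h0
  obtain ⟨κ, hκ⟩ := exists_smul_of_cross_eq_zero hs.ne hcross
  have hpp := dotProduct_self_pos hs.ne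
  -- As `a = κ p`, the map `1 + a ⊗ nU` multiplies `p` by `1 + a ⬝ nU`, which is its determinant.
  have hFp : p + (nU ⬝ᵥ p) • a = U.det • p := by
    rw [← hdetF, hκ, dotProduct_comm nU p, smul_dotProduct, add_smul, one_smul, smul_smul,
      smul_eq_mul, mul_comm]
  have hUU : U * U = (1 + tensor nU a) * (1 + tensor a nU) := by
    rw [← transpose_one_add_tensor, ← hF, Matrix.transpose_mul, h.transpose_left]
    calc U * U = U * 1 * U := by rw [mul_one]
      _ = U * RUᵀ * (RU * U) := by rw [← hR1]; simp only [Matrix.mul_assoc]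
  have e1 : (U * U) *ᵥ p = U.det • (p + (p ⬝ᵥ p) • g) := by
    have : (1 + tensor p g) *ᵥ p = U.det • p := by
      rw [one_add_tensor_mulVec, dotProduct_comm g p, hs.dot, sub_smul, one_smul]; abel
    rw [← hs.gram, ← Matrix.mulVec_mulVec, this, Matrix.mulVec_smul, one_add_tensor_mulVec]
  have e2 : (U * U) *ᵥ p = U.det • (p + (p ⬝ᵥ p) • (κ • nU)) := by
    rw [hUU, ← Matrix.mulVec_mulVec, one_add_tensor_mulVec a, hFp, Matrix.mulVec_smul,
      one_add_tensor_mulVec, hκ, smul_dotProduct, smul_smul, smul_eq_mul, mul_comm κ]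
  have hg : κ • nU = g := by
    have := e2.symm.trans e1
    have := smul_right_injective _ hD.ne' this
    have := add_left_cancel this
    exact smul_right_injective _ hpp.ne' this
  have hκ0 : κ ≠ 0 := by
    rintro rfl
    rw [zero_smul] at hg
    exact hs.normal_ne hD hg.symm
  refine ⟨κ, hκ0, hκ, hg, ?_⟩
  have hV : RV * V = RU * U + RU * tensor s m := by
    rw [hi.compatible, ← Matrix.mul_add, ← h.twinning, Matrix.mul_assoc]
    congr 1; abel
  rw [hi.interface_right, hF, mul_tensor, hRs, hFp, add_assoc] at hV
  have hV := add_left_cancel hV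
  rw [← hg]
  apply tensor_left_injective hs.ne
  rw [tensor_smul, tensor_add, tensor_smul, ← smul_tensor, ← hκ, hV, smul_smul, smul_tensor,
    tensor_smul, hκ, smul_tensor]

/-- The factorisation of `U²` says exactly that `(1 + p ⊗ g) U⁻¹` is orthogonal; it serves as `RU`.
-/
lemma ShearData.exists_interfaces {U V R : Mat3} {s m p g : Vec3} (h : IsTypeITwin U V R s m)
    (hs : ShearData U s m p g) :
    ∃ (κ : ℝ) (RU RV : Mat3) (nU nV : Vec3), κ ≠ 0 ∧ κ • nU = g ∧ κ • nV = g + (2 * U.det) • m ∧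
      TypeIInterfaces U V R s m RU RV (κ • p) nU nV := by
  have hD : 0 < U.det := h.posDef_left.det_pos
  have hg := hs.normal_ne hD
  have hgg := dotProduct_self_pos hg
  have hm : m ⬝ᵥ m = 1 := h.axis.1
  set κ := Real.sqrt (g ⬝ᵥ g) with hκ
  have hκ0 : κ ≠ 0 := (Real.sqrt_pos.mpr hgg).ne'
  have hκ2 : κ * κ = g ⬝ᵥ g := Real.mul_self_sqrt hgg.le
  have hUinv : IsUnit U.det := hD.ne'.isUnit
  have hRUU : ((1 + tensor p g) * U⁻¹) * U = 1 + tensor p g := by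
    rw [Matrix.mul_assoc, Matrix.nonsing_inv_mul _ hUinv, mul_one]
  have hRU : IsRotation ((1 + tensor p g) * U⁻¹) := by
    have h1 : ((1 + tensor p g) * U⁻¹)ᵀ * ((1 + tensor p g) * U⁻¹) = 1 := by
      rw [Matrix.transpose_mul, Matrix.transpose_nonsing_inv, h.transpose_left,
        transpose_one_add_tensor]
      calc U⁻¹ * (1 + tensor g p) * ((1 + tensor p g) * U⁻¹)
          = U⁻¹ * ((1 + tensor g p) * (1 + tensor p g)) * U⁻¹ := by simp only [Matrix.mul_assoc]
        _ = (U⁻¹ * U) * (U * U⁻¹) := by rw [hs.gram]; simp only [Matrix.mul_assoc]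
        _ = 1 := by
          rw [Matrix.nonsing_inv_mul _ hUinv, Matrix.mul_nonsing_inv _ hUinv, mul_one]
    refine isRotation_iff.mpr ⟨h1, mul_eq_one_comm.mp h1, ?_⟩
    rw [Matrix.det_mul, det_one_add_tensor, hs.dot, Matrix.det_nonsing_inv,
      Ring.inverse_eq_inv]
    field_simp
    ring
  have hFp : (1 + tensor p g) *ᵥ p = U.det • p := by
    rw [one_add_tensor_mulVec, dotProduct_comm, hs.dot, sub_smul, one_smul]; abel
  have hRs : ((1 + tensor p g) * U⁻¹) *ᵥ s = (2 * U.det) • p := by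
    rw [hs.shear, Matrix.mulVec_smul, Matrix.mulVec_mulVec, hRUU, hFp, smul_smul]
  have hten : ∀ v : Vec3, tensor (κ • p) (κ⁻¹ • v) = tensor p v := by
    intro v
    rw [smul_tensor, tensor_smul, smul_smul, mul_inv_cancel₀ hκ0, one_smul]
  have hk : ∀ v : Vec3, κ • κ⁻¹ • v = v := fun v => by
    rw [smul_smul, mul_inv_cancel₀ hκ0, one_smul]
  refine ⟨κ, (1 + tensor p g) * U⁻¹, (1 + tensor p g) * U⁻¹ * R, κ⁻¹ • g,
    κ⁻¹ • (g + (2 * U.det) • m), hκ0, hk _, hk _, hRU, hRU.mul h.rotation, ?_, ?_, ?_, ?_, ?_, ?_,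
    rfl⟩
  · simp only [IsUnitVec, smul_dotProduct, dotProduct_smul, smul_eq_mul]
    rw [← hκ2]; field_simp
  -- Since `g ⬝ m = -det U`, the vector `g + 2 (det U) m` is the mirror image of `g` in the plane
  -- orthogonal to `m`, so one factor `κ` normalises both normals.
  · have hgm := hs.dot_axis
    have hmg : m ⬝ᵥ g = -U.det := by rw [dotProduct_comm, hgm]
    simp only [IsUnitVec, smul_dotProduct, dotProduct_smul, smul_eq_mul, add_dotProduct,
      dotProduct_add, hm, hmg, hgm]
    rw [← hκ2]; field_simp; ring
  · rw [hRUU, hten]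
  · have : R * V = U + tensor s m := by rw [← h.twinning]; abel
    rw [Matrix.mul_assoc, this, Matrix.mul_add, hRUU, mul_tensor, hRs, hten, tensor_add,
      tensor_smul, smul_tensor, add_assoc]
  · rw [hRs]; simp
  · simp [dotProduct_comm _ m]

lemma IsStarFamily.of_smul {M : Set Mat3} {U V : Mat3} {a nU nV gU gV : Vec3} {μ κ : ℝ} {k : ℕ}
    {Q : Fin k → Mat3} (hκ : κ ≠ 0) (hU : κ • nU = gU) (hV : κ • nV = gV) :
    IsStarFamily M U V (κ • a) nU nV μ Q ↔ IsStarFamily M U V a gU gV μ Q := by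
  have hn : μ • gU + (1 - μ) • gV = κ • (μ • nU + (1 - μ) • nV) := by
    rw [← hU, ← hV, smul_add, smul_comm κ μ, smul_comm κ (1 - μ)]
  constructor
  · rintro ⟨h1, h2, h3, h4, h5, h6, h7, h8⟩
    refine ⟨h1, h2, h3, h4, h5, fun i => ?_, fun i j hij => ?_, fun i j l hij hil hjl => ?_⟩
    · obtain ⟨χ, hχ, h⟩ := h6 i
      exact ⟨χ, hχ, by rw [hn, Matrix.mulVec_smul, h, smul_comm]⟩
    · have := h7 i j hij
      simp only [Matrix.mulVec_smul, map_smul, LinearMap.smul_apply, smul_dotProduct,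
        dotProduct_smul, smul_eq_mul] at this
      exact fun h0 => this (by rw [h0]; simp)
    · have := h8 i j l hij hil hjl
      simp only [Matrix.mulVec_smul, map_smul, LinearMap.smul_apply, smul_dotProduct,
        dotProduct_smul, smul_eq_mul] at this
      exact fun h0 => this (by rw [h0]; simp)
  · rintro ⟨h1, h2, h3, h4, h5, h6, h7, h8⟩
    refine ⟨h1, h2, h3, h4, h5, fun i => ?_, fun i j hij => ?_, fun i j l hij hil hjl => ?_⟩
    · obtain ⟨χ, hχ, h⟩ := h6 i
      refine ⟨χ, hχ, ?_⟩
      rw [hn, Matrix.mulVec_smul, smul_comm χ κ] at h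
      exact smul_right_injective _ hκ h
    · simp only [Matrix.mulVec_smul, map_smul, LinearMap.smul_apply, smul_dotProduct,
        dotProduct_smul, smul_eq_mul]
      exact mul_ne_zero hκ (mul_ne_zero hκ (mul_ne_zero hκ (h7 i j hij)))
    · simp only [Matrix.mulVec_smul, map_smul, LinearMap.smul_apply, smul_dotProduct,
        dotProduct_smul, smul_eq_mul]
      exact mul_ne_zero hκ (mul_ne_zero hκ (mul_ne_zero hκ (h8 i j l hij hil hjl)))

lemma hasStarFamily_iff {M : Set Mat3} {U V R : Mat3} {s m p g : Vec3} (hU : U ∈ M) (hV : V ∈ M)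
    (h : IsTypeITwin U V R s m) (hc : CofactorConditions U s m) (hs : ShearData U s m p g)
    (k : ℕ) :
    HasStarFamily k M U V R s m ↔ ∃ μ : ℝ, 0 < μ ∧ μ < 1 ∧ ∃ Q : Fin k → Mat3,
      IsStarFamily M U V p g (g + (2 * U.det) • m) μ Q := by
  constructor
  · rintro ⟨-, -, -, -, RU, RV, a, nU, nV, hi, μ, h0, h1, Q, hQ⟩
    obtain ⟨κ, hκ, rfl, hgU, hgV⟩ := hs.interfaces_eq h hi
    exact ⟨μ, h0, h1, Q, (IsStarFamily.of_smul hκ hgU hgV).mp hQ⟩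
  · rintro ⟨μ, h0, h1, Q, hQ⟩
    obtain ⟨κ, RU, RV, nU, nV, hκ, hgU, hgV, hi⟩ := hs.exists_interfaces h
    exact ⟨hU, hV, h, hc, RU, RV, κ • p, nU, nV, hi, μ, h0, h1, Q,
      (IsStarFamily.of_smul hκ hgU hgV).mpr hQ⟩

/-! ### The cubic rotations and their action on the twelve variants -/

/-- The rotations that permute the coordinate axes. -/
def IsCubicRotation (Q : Mat3) : Prop :=
  IsRotation Q ∧ ∀ j, ∃ k, ∃ s : ℝ, (s = 1 ∨ s = -1) ∧ ∀ i, Q i j = if i = k then s else 0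

/-- The six shapes of a signed permutation matrix of determinant one. -/
def IsSignedPermutation (Q : Mat3) : Prop :=
  ∃ x y z : ℝ, (x = 1 ∨ x = -1) ∧ (y = 1 ∨ y = -1) ∧ (z = 1 ∨ z = -1) ∧
    ((x * y * z = 1 ∧ (Q = !![x, 0, 0; 0, y, 0; 0, 0, z] ∨ Q = !![0, x, 0; 0, 0, y; z, 0, 0] ∨
        Q = !![0, 0, x; y, 0, 0; 0, z, 0])) ∨
      (x * y * z = -1 ∧ (Q = !![x, 0, 0; 0, 0, y; 0, z, 0] ∨ Q = !![0, 0, x; 0, y, 0; z, 0, 0] ∨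
        Q = !![0, x, 0; y, 0, 0; 0, 0, z])))

lemma IsCubicRotation.isSignedPermutation {Q : Mat3} (h : IsCubicRotation Q) :
    IsSignedPermutation Q := by
  obtain ⟨hR, hQ⟩ := h
  obtain ⟨k0, s0, hs0, h0⟩ := hQ 0
  obtain ⟨k1, s1, hs1, h1⟩ := hQ 1
  obtain ⟨k2, s2, hs2, h2⟩ := hQ 2
  have hdet := (isRotation_iff.mp hR).2.2
  have hform : Q = !![Q 0 0, Q 0 1, Q 0 2; Q 1 0, Q 1 1, Q 1 2; Q 2 0, Q 2 1, Q 2 2] :=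
    Matrix.eta_fin_three Q
  simp only [h0, h1, h2] at hform
  rw [Matrix.det_fin_three] at hdet
  simp only [h0, h1, h2] at hdet
  -- Of the 27 choices of target axes, those repeating an axis contradict `det Q = 1`; six remain.
  fin_cases k0 <;> fin_cases k1 <;> fin_cases k2 <;> simp at hdet hform
  · exact ⟨s0, s1, s2, hs0, hs1, hs2, Or.inl ⟨hdet, Or.inl hform⟩⟩
  · exact ⟨s0, s2, s1, hs0, hs2, hs1, Or.inr ⟨by linarith, Or.inl hform⟩⟩
  · exact ⟨s1, s0, s2, hs1, hs0, hs2, Or.inr ⟨by linarith, Or.inr (Or.inr hform)⟩⟩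
  · exact ⟨s2, s0, s1, hs2, hs0, hs1, Or.inl ⟨by linarith, Or.inr (Or.inr hform)⟩⟩
  · exact ⟨s1, s2, s0, hs1, hs2, hs0, Or.inl ⟨by linarith, Or.inr (Or.inl hform)⟩⟩
  · exact ⟨s2, s1, s0, hs2, hs1, hs0, Or.inr ⟨by linarith, Or.inr (Or.inl hform)⟩⟩

lemma IsSignedPermutation.isCubicRotation {Q : Mat3} (h : IsSignedPermutation Q) :
    IsCubicRotation Q := by
  obtain ⟨x, y, z, hx, hy, hz, h⟩ := h
  have hx2 : x * x = 1 := by rcases hx with rfl | rfl <;> norm_num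
  have hy2 : y * y = 1 := by rcases hy with rfl | rfl <;> norm_num
  have hz2 : z * z = 1 := by rcases hz with rfl | rfl <;> norm_num
  refine ⟨isRotation_iff.mpr ?_, ?_⟩
  · rw [mul_eq_one_comm, ← and_assoc, and_self]
    rcases h with ⟨hd, rfl | rfl | rfl⟩ | ⟨hd, rfl | rfl | rfl⟩ <;>
      refine ⟨?_, by simp [Matrix.det_fin_three]; linarith⟩ <;>
      ext i j <;> fin_cases i <;> fin_cases j <;>
      simp [Matrix.mul_apply, Fin.sum_univ_three, hx2, hy2, hz2]
  · rcases h with ⟨-, rfl | rfl | rfl⟩ | ⟨-, rfl | rfl | rfl⟩ <;> intro j <;> fin_cases j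
    · exact ⟨0, x, hx, fun i => by fin_cases i <;> simp⟩
    · exact ⟨1, y, hy, fun i => by fin_cases i <;> simp⟩
    · exact ⟨2, z, hz, fun i => by fin_cases i <;> simp⟩
    · exact ⟨2, z, hz, fun i => by fin_cases i <;> simp⟩
    · exact ⟨0, x, hx, fun i => by fin_cases i <;> simp⟩
    · exact ⟨1, y, hy, fun i => by fin_cases i <;> simp⟩
    · exact ⟨1, y, hy, fun i => by fin_cases i <;> simp⟩
    · exact ⟨2, z, hz, fun i => by fin_cases i <;> simp⟩
    · exact ⟨0, x, hx, fun i => by fin_cases i <;> simp⟩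
    · exact ⟨0, x, hx, fun i => by fin_cases i <;> simp⟩
    · exact ⟨2, z, hz, fun i => by fin_cases i <;> simp⟩
    · exact ⟨1, y, hy, fun i => by fin_cases i <;> simp⟩
    · exact ⟨2, z, hz, fun i => by fin_cases i <;> simp⟩
    · exact ⟨1, y, hy, fun i => by fin_cases i <;> simp⟩
    · exact ⟨0, x, hx, fun i => by fin_cases i <;> simp⟩
    · exact ⟨1, y, hy, fun i => by fin_cases i <;> simp⟩
    · exact ⟨0, x, hx, fun i => by fin_cases i <;> simp⟩
    · exact ⟨2, z, hz, fun i => by fin_cases i <;> simp⟩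

lemma isCubicRotation_iff {Q : Mat3} : IsCubicRotation Q ↔ IsSignedPermutation Q :=
  ⟨fun h => h.isSignedPermutation, fun h => h.isCubicRotation⟩

lemma IsCubicRotation.transpose {Q : Mat3} (h : IsCubicRotation Q) : IsCubicRotation Qᵀ := by
  rw [isCubicRotation_iff] at *
  obtain ⟨x, y, z, hx, hy, hz, ⟨hd, rfl | rfl | rfl⟩ | ⟨hd, rfl | rfl | rfl⟩⟩ := h
  · exact ⟨x, y, z, hx, hy, hz, Or.inl ⟨hd, Or.inl (by
      ext i j; fin_cases i <;> fin_cases j <;> simp)⟩⟩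
  · exact ⟨z, x, y, hz, hx, hy, Or.inl ⟨by linarith, Or.inr (Or.inr (by
      ext i j; fin_cases i <;> fin_cases j <;> simp))⟩⟩
  · exact ⟨y, z, x, hy, hz, hx, Or.inl ⟨by linarith, Or.inr (Or.inl (by
      ext i j; fin_cases i <;> fin_cases j <;> simp))⟩⟩
  · exact ⟨x, z, y, hx, hz, hy, Or.inr ⟨by linarith, Or.inl (by
      ext i j; fin_cases i <;> fin_cases j <;> simp)⟩⟩
  · exact ⟨z, y, x, hz, hy, hx, Or.inr ⟨by linarith, Or.inr (Or.inl (by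
      ext i j; fin_cases i <;> fin_cases j <;> simp))⟩⟩
  · exact ⟨y, x, z, hy, hx, hz, Or.inr ⟨by linarith, Or.inr (Or.inr (by
      ext i j; fin_cases i <;> fin_cases j <;> simp))⟩⟩

lemma IsCubicRotation.mul {P Q : Mat3} (hP : IsCubicRotation P) (hQ : IsCubicRotation Q) :
    IsCubicRotation (P * Q) := by
  refine ⟨hP.1.mul hQ.1, fun j => ?_⟩
  obtain ⟨k, s, hs, h⟩ := hQ.2 j
  obtain ⟨k', s', hs', h'⟩ := hP.2 k
  refine ⟨k', s' * s, by rcases hs with rfl | rfl <;> rcases hs' with rfl | rfl <;> norm_num,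
    fun i => ?_⟩
  simp [Matrix.mul_apply, h, h']

/-- The matrix `U₁`, with an off-diagonal entry of either sign. -/
def blockMatrix (a b c d : ℝ) : Mat3 := !![a, b, 0; b, c, 0; 0, 0, d]

lemma exists_cubicMonoclinic_eq (a b c d : ℝ) (k : Fin 12) :
    ∃ P, IsCubicRotation P ∧ cubicMonoclinic a b c d k = P * blockMatrix a b c d * Pᵀ := by
  have key : ∀ P : Mat3, IsSignedPermutation P →
      cubicMonoclinic a b c d k = P * blockMatrix a b c d * Pᵀ →
      ∃ P, IsCubicRotation P ∧ cubicMonoclinic a b c d k = P * blockMatrix a b c d * Pᵀ :=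
    fun P h h' => ⟨P, h.isCubicRotation, h'⟩
  fin_cases k
  · refine key _ ⟨1, 1, 1, by simp, by simp, by simp, .inl ⟨by norm_num, .inl rfl⟩⟩ ?_
    ext i j; fin_cases i <;> fin_cases j <;>
      simp [cubicMonoclinic, blockMatrix, Matrix.mul_apply, Fin.sum_univ_three]
  · refine key _ ⟨1, -1, -1, by simp, by simp, by simp, .inl ⟨by norm_num, .inl rfl⟩⟩ ?_
    ext i j; fin_cases i <;> fin_cases j <;>
      simp [cubicMonoclinic, blockMatrix, Matrix.mul_apply, Fin.sum_univ_three]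
  · refine key _ ⟨1, 1, -1, by simp, by simp, by simp, .inr ⟨by norm_num, .inr (.inr rfl)⟩⟩ ?_
    ext i j; fin_cases i <;> fin_cases j <;>
      simp [cubicMonoclinic, blockMatrix, Matrix.mul_apply, Fin.sum_univ_three]
  · refine key _ ⟨1, -1, 1, by simp, by simp, by simp, .inr ⟨by norm_num, .inr (.inr rfl)⟩⟩ ?_
    ext i j; fin_cases i <;> fin_cases j <;>
      simp [cubicMonoclinic, blockMatrix, Matrix.mul_apply, Fin.sum_univ_three]
  · refine key _ ⟨1, -1, 1, by simp, by simp, by simp, .inr ⟨by norm_num, .inl rfl⟩⟩ ?_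
    ext i j; fin_cases i <;> fin_cases j <;>
      simp [cubicMonoclinic, blockMatrix, Matrix.mul_apply, Fin.sum_univ_three]
  · refine key _ ⟨1, 1, -1, by simp, by simp, by simp, .inr ⟨by norm_num, .inl rfl⟩⟩ ?_
    ext i j; fin_cases i <;> fin_cases j <;>
      simp [cubicMonoclinic, blockMatrix, Matrix.mul_apply, Fin.sum_univ_three]
  · refine key _ ⟨1, 1, 1, by simp, by simp, by simp, .inl ⟨by norm_num, .inr (.inl rfl)⟩⟩ ?_
    ext i j; fin_cases i <;> fin_cases j <;>
      simp [cubicMonoclinic, blockMatrix, Matrix.mul_apply, Fin.sum_univ_three]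
  · refine key _ ⟨1, -1, -1, by simp, by simp, by simp, .inl ⟨by norm_num, .inr (.inl rfl)⟩⟩ ?_
    ext i j; fin_cases i <;> fin_cases j <;>
      simp [cubicMonoclinic, blockMatrix, Matrix.mul_apply, Fin.sum_univ_three]
  · refine key _ ⟨1, 1, 1, by simp, by simp, by simp, .inl ⟨by norm_num, .inr (.inr rfl)⟩⟩ ?_
    ext i j; fin_cases i <;> fin_cases j <;>
      simp [cubicMonoclinic, blockMatrix, Matrix.mul_apply, Fin.sum_univ_three]
  · refine key _ ⟨-1, 1, -1, by simp, by simp, by simp, .inl ⟨by norm_num, .inr (.inr rfl)⟩⟩ ?_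
    ext i j; fin_cases i <;> fin_cases j <;>
      simp [cubicMonoclinic, blockMatrix, Matrix.mul_apply, Fin.sum_univ_three]
  · refine key _ ⟨-1, 1, 1, by simp, by simp, by simp, .inr ⟨by norm_num, .inr (.inl rfl)⟩⟩ ?_
    ext i j; fin_cases i <;> fin_cases j <;>
      simp [cubicMonoclinic, blockMatrix, Matrix.mul_apply, Fin.sum_univ_three]
  · refine key _ ⟨1, 1, -1, by simp, by simp, by simp, .inr ⟨by norm_num, .inr (.inl rfl)⟩⟩ ?_
    ext i j; fin_cases i <;> fin_cases j <;>
      simp [cubicMonoclinic, blockMatrix, Matrix.mul_apply, Fin.sum_univ_three]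

/-- The position of the nonzero entries depends only on the shape of `P`, and the sign of the
off-diagonal entry is a product of two of its signs; this selects one of a pair of variants. -/
lemma conj_blockMatrix_mem_range (a b c d : ℝ) {P : Mat3} (hP : IsCubicRotation P) :
    P * blockMatrix a b c d * Pᵀ ∈ Set.range (cubicMonoclinic a b c d) := by
  have key : ∀ (t : ℝ) (k l : Fin 12), (t = 1 ∨ t = -1) →
      (t = 1 → cubicMonoclinic a b c d k = P * blockMatrix a b c d * Pᵀ) →
      (t = -1 → cubicMonoclinic a b c d l = P * blockMatrix a b c d * Pᵀ) →
      P * blockMatrix a b c d * Pᵀ ∈ Set.range (cubicMonoclinic a b c d) := by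
    rintro t k l (h | h) h1 h2
    · exact ⟨k, h1 h⟩
    · exact ⟨l, h2 h⟩
  obtain ⟨x, y, z, hx, hy, hz, h⟩ := hP.isSignedPermutation
  have hx2 : x * x = 1 := by rcases hx with rfl | rfl <;> norm_num
  have hy2 : y * y = 1 := by rcases hy with rfl | rfl <;> norm_num
  have hz2 : z * z = 1 := by rcases hz with rfl | rfl <;> norm_num
  have hxy : x * y = 1 ∨ x * y = -1 := by
    rcases hx with rfl | rfl <;> rcases hy with rfl | rfl <;> norm_num
  have hxz : x * z = 1 ∨ x * z = -1 := by
    rcases hx with rfl | rfl <;> rcases hz with rfl | rfl <;> norm_num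
  have hyz : y * z = 1 ∨ y * z = -1 := by
    rcases hy with rfl | rfl <;> rcases hz with rfl | rfl <;> norm_num
  rcases h with ⟨hd, rfl | rfl | rfl⟩ | ⟨hd, rfl | rfl | rfl⟩
  · refine key (x * y) 0 1 hxy ?_ ?_ <;> intro ht <;> ext i j <;> fin_cases i <;> fin_cases j <;>
      simp [cubicMonoclinic, blockMatrix, Matrix.mul_apply, Fin.sum_univ_three] <;> grind
  · refine key (x * z) 6 7 hxz ?_ ?_ <;> intro ht <;> ext i j <;> fin_cases i <;> fin_cases j <;>
      simp [cubicMonoclinic, blockMatrix, Matrix.mul_apply, Fin.sum_univ_three] <;> grind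
  · refine key (y * z) 8 9 hyz ?_ ?_ <;> intro ht <;> ext i j <;> fin_cases i <;> fin_cases j <;>
      simp [cubicMonoclinic, blockMatrix, Matrix.mul_apply, Fin.sum_univ_three] <;> grind
  · refine key (x * z) 4 5 hxz ?_ ?_ <;> intro ht <;> ext i j <;> fin_cases i <;> fin_cases j <;>
      simp [cubicMonoclinic, blockMatrix, Matrix.mul_apply, Fin.sum_univ_three] <;> grind
  · refine key (y * z) 10 11 hyz ?_ ?_ <;> intro ht <;> ext i j <;> fin_cases i <;>
      fin_cases j <;>
      simp [cubicMonoclinic, blockMatrix, Matrix.mul_apply, Fin.sum_univ_three] <;> grind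
  · refine key (x * y) 2 3 hxy ?_ ?_ <;> intro ht <;> ext i j <;> fin_cases i <;> fin_cases j <;>
      simp [cubicMonoclinic, blockMatrix, Matrix.mul_apply, Fin.sum_univ_three] <;> grind

lemma conj_mem_range {a b c d : ℝ} {P A : Mat3} (hP : IsCubicRotation P)
    (hA : A ∈ Set.range (cubicMonoclinic a b c d)) :
    P * A * Pᵀ ∈ Set.range (cubicMonoclinic a b c d) := by
  obtain ⟨k, rfl⟩ := hA
  obtain ⟨P', hP', h⟩ := exists_cubicMonoclinic_eq a b c d k
  have := conj_blockMatrix_mem_range a b c d (hP.mul hP')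
  rw [h]
  simpa [Matrix.transpose_mul, Matrix.mul_assoc] using this

/-! ### Families of cubic rotations, up to conjugation and scaling -/

lemma triple_mulVec (P : Mat3) (u v w : Vec3) :
    crossProduct (P *ᵥ u) (P *ᵥ v) ⬝ᵥ (P *ᵥ w) = P.det * (crossProduct u v ⬝ᵥ w) := by
  simp [cross_apply, dotProduct, Matrix.mulVec, Matrix.det_fin_three, Fin.sum_univ_three]
  ring

/-- A family of nontrivial cubic rotations fixing the line of `n` and moving `a` to vectors in
general position. -/
structure IsOrbitFamily (a n : Vec3) {k : ℕ} (Q : Fin k → Mat3) : Prop where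
  injective : Function.Injective Q
  cubic : ∀ i, IsCubicRotation (Q i)
  ne_one : ∀ i, Q i ≠ 1
  normal : ∀ i, Q i *ᵥ n = n ∨ Q i *ᵥ n = -n
  indep : ∀ i j, i ≠ j → (crossProduct (Q i *ᵥ a) (Q j *ᵥ a)) ⬝ᵥ a ≠ 0
  indep_triple : ∀ i j l, i ≠ j → i ≠ l → j ≠ l →
    (crossProduct (Q i *ᵥ a) (Q j *ᵥ a)) ⬝ᵥ (Q l *ᵥ a) ≠ 0

lemma IsRotation.mul_cancel {P : Mat3} (hP : IsRotation P) (A : Mat3) : Pᵀ * (P * A) = A := by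
  rw [← Matrix.mul_assoc, (isRotation_iff.mp hP).1, one_mul]

lemma IsRotation.mulVec_cancel {P : Mat3} (hP : IsRotation P) (v : Vec3) :
    Pᵀ *ᵥ (P *ᵥ v) = v := by
  rw [Matrix.mulVec_mulVec, (isRotation_iff.mp hP).1, Matrix.one_mulVec]

lemma IsRotation.mulVec_cancel' {P : Mat3} (hP : IsRotation P) (v : Vec3) :
    P *ᵥ (Pᵀ *ᵥ v) = v := by
  rw [Matrix.mulVec_mulVec, (isRotation_iff.mp hP).2.1, Matrix.one_mulVec]

lemma IsRotation.dotProduct_mulVec {P : Mat3} (hP : IsRotation P) (u v : Vec3) :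
    (P *ᵥ u) ⬝ᵥ (P *ᵥ v) = u ⬝ᵥ v := by
  rw [Matrix.dotProduct_mulVec, ← Matrix.mulVec_transpose, hP.mulVec_cancel]

lemma IsRotation.conj_conj {P : Mat3} (hP : IsRotation P) (A : Mat3) :
    Pᵀ * (P * A * Pᵀ) * P = A := by
  rw [Matrix.mul_assoc P, hP.mul_cancel, Matrix.mul_assoc, (isRotation_iff.mp hP).1, mul_one]

lemma IsOrbitFamily.conj {P : Mat3} (hP : IsCubicRotation P) {a n : Vec3} {k : ℕ}
    {Q : Fin k → Mat3} (h : IsOrbitFamily a n Q) :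
    IsOrbitFamily (P *ᵥ a) (P *ᵥ n) (fun i => P * Q i * Pᵀ) := by
  obtain ⟨h1, h2, h3, h4, h5, h6⟩ := h
  have hdet := (isRotation_iff.mp hP.1).2.2
  have hc : ∀ i v, (P * Q i * Pᵀ) *ᵥ (P *ᵥ v) = P *ᵥ (Q i *ᵥ v) := by
    intro i v
    rw [← Matrix.mulVec_mulVec, hP.1.mulVec_cancel, Matrix.mulVec_mulVec]
  refine ⟨fun i j hij => h1 ?_, fun i => (hP.mul (h2 i)).mul hP.transpose, fun i hi => h3 i ?_,
    fun i => ?_, fun i j hij => ?_, fun i j l hij hil hjl => ?_⟩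
  · rw [← hP.1.conj_conj (Q i), ← hP.1.conj_conj (Q j)]; rw [hij]
  · rw [← hP.1.conj_conj (Q i)]
    rw [hi, mul_one, (isRotation_iff.mp hP.1).1]
  · rw [hc]
    rcases h4 i with h | h <;> rw [h]
    · exact Or.inl rfl
    · exact Or.inr (Matrix.mulVec_neg _ _)
  · simp only [hc, triple_mulVec, hdet, one_mul]
    exact h5 i j hij
  · simp only [hc, triple_mulVec, hdet, one_mul]
    exact h6 i j l hij hil hjl

lemma exists_isOrbitFamily_conj {P : Mat3} (hP : IsCubicRotation P) (a n : Vec3) (k : ℕ) :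
    (∃ Q : Fin k → Mat3, IsOrbitFamily (P *ᵥ a) (P *ᵥ n) Q) ↔
      ∃ Q : Fin k → Mat3, IsOrbitFamily a n Q := by
  constructor
  · rintro ⟨Q, hQ⟩
    have := hQ.conj hP.transpose
    rw [hP.1.mulVec_cancel, hP.1.mulVec_cancel] at this
    exact ⟨_, this⟩
  · rintro ⟨Q, hQ⟩
    exact ⟨_, hQ.conj hP⟩

lemma IsOrbitFamily.smul {a n : Vec3} {k : ℕ} {Q : Fin k → Mat3} {α β : ℝ} (hα : α ≠ 0)
    (h : IsOrbitFamily a n Q) : IsOrbitFamily (α • a) (β • n) Q := by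
  obtain ⟨h1, h2, h3, h4, h5, h6⟩ := h
  refine ⟨h1, h2, h3, fun i => ?_, fun i j hij => ?_, fun i j l hij hil hjl => ?_⟩
  · rw [Matrix.mulVec_smul, ← smul_neg]
    rcases h4 i with h | h <;> rw [h] <;> simp
  · simp only [Matrix.mulVec_smul, map_smul, LinearMap.smul_apply, smul_dotProduct,
      dotProduct_smul, smul_eq_mul]
    exact mul_ne_zero hα (mul_ne_zero hα (mul_ne_zero hα (h5 i j hij)))
  · simp only [Matrix.mulVec_smul, map_smul, LinearMap.smul_apply, smul_dotProduct,
      dotProduct_smul, smul_eq_mul]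
    exact mul_ne_zero hα (mul_ne_zero hα (mul_ne_zero hα (h6 i j l hij hil hjl)))

lemma isOrbitFamily_smul_iff {a n : Vec3} {k : ℕ} {Q : Fin k → Mat3} {α β : ℝ} (hα : α ≠ 0)
    (hβ : β ≠ 0) : IsOrbitFamily (α • a) (β • n) Q ↔ IsOrbitFamily a n Q := by
  refine ⟨fun h => ?_, fun h => h.smul hα⟩
  have := h.smul (β := β⁻¹) (inv_ne_zero hα)
  rwa [inv_smul_smul₀ hα, inv_smul_smul₀ hβ] at this

/-! ### Rotations that carry the twin into the set of variants -/

lemma eq_zero_of_two_by_two {A B C p q : ℝ} (h : A * C ≠ B ^ 2) (h1 : A * p + B * q = 0)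
    (h2 : B * p + C * q = 0) : p = 0 ∧ q = 0 := by
  have hne : A * C - B ^ 2 ≠ 0 := sub_ne_zero.mpr h
  constructor
  · apply mul_left_cancel₀ hne; linear_combination C * h1 - B * h2
  · apply mul_left_cancel₀ hne; linear_combination A * h2 - B * h1

/-- The hypothesis says that `d` is not an eigenvalue of the 2 × 2 block, so its eigenspace in each
variant is the monoclinic axis. -/
lemma exists_axis_of_eigenvector {a b c d : ℝ} (hne : (a - d) * (c - d) ≠ b ^ 2) {A : Mat3}
    (hA : A ∈ Set.range (cubicMonoclinic a b c d)) {x : Vec3} (hx : A *ᵥ x = d • x) :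
    ∃ k, ∀ i, i ≠ k → x i = 0 := by
  obtain ⟨j, rfl⟩ := hA
  obtain ⟨P, hP, h⟩ := exists_cubicMonoclinic_eq a b c d j
  have hy : blockMatrix a b c d *ᵥ (Pᵀ *ᵥ x) = d • (Pᵀ *ᵥ x) := by
    rw [← Matrix.mulVec_smul, ← hx, h, ← Matrix.mulVec_mulVec, ← Matrix.mulVec_mulVec,
      hP.1.mulVec_cancel]
  set y := Pᵀ *ᵥ x with hyx
  have h0 := congrFun hy 0
  have h1 := congrFun hy 1
  simp [blockMatrix, Matrix.mulVec, dotProduct, Fin.sum_univ_three] at h0 h1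
  obtain ⟨hy0, hy1⟩ := eq_zero_of_two_by_two (p := y 0) (q := y 1) hne (by linarith) (by linarith)
  obtain ⟨k, s, -, hk⟩ := hP.2 2
  refine ⟨k, fun i hi => ?_⟩
  have hxy : x = P *ᵥ y := by rw [hyx, hP.1.mulVec_cancel']
  rw [hxy]
  simp [Matrix.mulVec, dotProduct, Fin.sum_univ_three, hy0, hy1, hk, hi]

/-- An entry `±1` in an orthogonal matrix annihilates the rest of its row, so two coordinate columns
force the third. -/
lemma isCubicRotation_of_two_columns {Q : Mat3} (hQ : IsRotation Q) {j l : Fin 3} (hjl : j ≠ l)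
    (hj : ∃ k, ∀ i, i ≠ k → Q i j = 0) (hl : ∃ k, ∀ i, i ≠ k → Q i l = 0) :
    IsCubicRotation Q := by
  obtain ⟨h1, h2, -⟩ := isRotation_iff.mp hQ
  have hcol : ∀ j k, (∀ i, i ≠ k → Q i j = 0) → Q k j ^ 2 = 1 := by
    intro j k h
    have := congrFun (congrFun h1 j) j
    rw [Matrix.mul_apply, Finset.sum_eq_single k] at this
    · simpa [sq] using this
    · intro i _ hi; simp [h i hi]
    · simp
  have hrow : ∀ j k, Q k j ^ 2 = 1 → ∀ j', j' ≠ j → Q k j' = 0 := by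
    intro j k h j' hj'
    have := congrFun (congrFun h2 k) k
    rw [Matrix.mul_apply, ← Finset.add_sum_erase _ _ (Finset.mem_univ j)] at this
    have h0 : ∑ x ∈ Finset.univ.erase j, Q k x * Qᵀ x k = 0 := by
      simp only [Matrix.transpose_apply, Matrix.one_apply_eq] at this ⊢
      nlinarith
    have h00 := (Finset.sum_eq_zero_iff_of_nonneg (fun x _ => by
      simp only [Matrix.transpose_apply]; exact mul_self_nonneg _)).mp h0 j' (by simp [hj'])
    simpa using h00
  have hdone : ∀ j, (∃ k, ∀ i, i ≠ k → Q i j = 0) →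
      ∃ k, ∃ s : ℝ, (s = 1 ∨ s = -1) ∧ ∀ i, Q i j = if i = k then s else 0 := by
    rintro j ⟨k, h⟩
    refine ⟨k, Q k j, by simpa using hcol j k h, fun i => ?_⟩
    split_ifs with hi
    · rw [hi]
    · exact h i hi
  obtain ⟨k, hk⟩ := hj
  obtain ⟨k', hk'⟩ := hl
  have hk1 := hcol j k hk
  have hk1' := hcol l k' hk'
  have hkk : k ≠ k' := by
    rintro rfl
    have := hrow l k hk1' j hjl
    rw [this] at hk1
    norm_num at hk1
  -- Two distinct indices out of three leave a single row for the remaining column.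
  have hthird : ∃ r, ∀ i, i ≠ r → i = k ∨ i = k' := by
    clear * - hkk
    revert k k'; decide
  refine ⟨hQ, fun j' => ?_⟩
  by_cases hj' : j' = j
  · rw [hj']; exact hdone j ⟨k, hk⟩
  by_cases hl' : j' = l
  · rw [hl']; exact hdone l ⟨k', hk'⟩
  obtain ⟨r, hr⟩ := hthird
  refine hdone j' ⟨r, fun i hi => ?_⟩
  rcases hr i hi with rfl | rfl
  · exact hrow j _ hk1 j' hj'
  · exact hrow l _ hk1' j' hl'

/-- The monoclinic axes of `U` and `V` are `P e_j` and `P e_l`. A rotation `Q` taking both matrices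
to variants takes these axes to coordinate axes, so `Q P`, and with it `Q`, is cubic. Conversely
cubic rotations permute the variants. -/
lemma isStarFamily_iff {a b c d : ℝ} (hne : (a - d) * (c - d) ≠ b ^ 2) {U V P : Mat3}
    (hU : U ∈ Set.range (cubicMonoclinic a b c d)) (hV : V ∈ Set.range (cubicMonoclinic a b c d))
    (hP : IsCubicRotation P) {j l : Fin 3} (hjl : j ≠ l)
    (hUj : U *ᵥ (P *ᵥ Pi.single j 1) = d • (P *ᵥ Pi.single j 1))
    (hVl : V *ᵥ (P *ᵥ Pi.single l 1) = d • (P *ᵥ Pi.single l 1))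
    {v nU nV : Vec3} {μ : ℝ} {k : ℕ} {Q : Fin k → Mat3} :
    IsStarFamily (Set.range (cubicMonoclinic a b c d)) U V v nU nV μ Q ↔
      IsOrbitFamily v (μ • nU + (1 - μ) • nV) Q := by
  have haxis : ∀ {A S : Mat3} {j : Fin 3}, IsRotation S →
      A *ᵥ (P *ᵥ Pi.single j 1) = d • (P *ᵥ Pi.single j 1) →
      S * A * Sᵀ ∈ Set.range (cubicMonoclinic a b c d) → ∃ k, ∀ i, i ≠ k → (S * P) i j = 0 := by
    intro A S j hS hA hmem
    have : (S * A * Sᵀ) *ᵥ (S *ᵥ (P *ᵥ Pi.single j 1)) = d • (S *ᵥ (P *ᵥ Pi.single j 1)) := by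
      rw [← Matrix.mulVec_mulVec, hS.mulVec_cancel, ← Matrix.mulVec_mulVec, hA,
        Matrix.mulVec_smul]
    obtain ⟨k, hk⟩ := exists_axis_of_eigenvector hne hmem this
    refine ⟨k, fun i hi => ?_⟩
    have := hk i hi
    rw [Matrix.mulVec_mulVec] at this
    simpa using this
  constructor
  · rintro ⟨h1, h2, h3, h4, h5, h6, h7, h8⟩
    refine ⟨h1, fun i => ?_, h3, fun i => ?_, h7, h8⟩
    · have := isCubicRotation_of_two_columns ((h2 i).mul hP.1) hjl
        (haxis (h2 i) hUj (h4 i)) (haxis (h2 i) hVl (h5 i))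
      have := this.mul hP.transpose
      rwa [Matrix.mul_assoc, (isRotation_iff.mp hP.1).2.1, mul_one] at this
    · obtain ⟨χ, rfl | rfl, h⟩ := h6 i
      · left; rw [h, one_smul]
      · right; rw [h, neg_smul, one_smul]
  · rintro ⟨h1, h2, h3, h4, h5, h6⟩
    refine ⟨h1, fun i => (h2 i).1, h3, fun i => conj_mem_range (h2 i) hU,
      fun i => conj_mem_range (h2 i) hV, fun i => ?_, h5, h6⟩
    rcases h4 i with h | h
    · exact ⟨1, Or.inl rfl, by rw [h, one_smul]⟩
    · exact ⟨-1, Or.inr rfl, by rw [h, neg_smul, one_smul]⟩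

/-! ### Twin axes of the variants and the normal form -/

/-- `m` is the twin axis of the distinct matrices `U`, `V`, unique up to sign. -/
structure IsUniqueTwinAxis (U V : Mat3) (m : Vec3) : Prop where
  ne : U ≠ V
  axis : IsTwinAxis U V m
  unique : ∀ e : Vec3, IsTwinAxis U V e → e = m ∨ e = -m

lemma IsTypeITwin.isUniqueTwinAxis {U V R : Mat3} {s m : Vec3} (h : IsTypeITwin U V R s m) :
    IsUniqueTwinAxis U V m := ⟨h.ne, h.axis, h.axis_unique⟩

lemma halfTurn_mulVec (e x : Vec3) : halfTurn e *ᵥ x = (2 * (e ⬝ᵥ x)) • e - x := by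
  rw [halfTurn, Matrix.add_mulVec, Matrix.neg_mulVec, Matrix.one_mulVec, Matrix.smul_mulVec,
    tensor_mulVec, smul_smul]
  abel

lemma transpose_halfTurn (e : Vec3) : (halfTurn e)ᵀ = halfTurn e := by
  simp [halfTurn, transpose_tensor]

lemma halfTurn_mul_self {e : Vec3} (he : IsUnitVec e) : halfTurn e * halfTurn e = 1 := by
  have : tensor e e * tensor e e = tensor e e := by
    rw [mul_tensor, tensor_mulVec, he, one_smul]
  simp only [halfTurn, mul_add, add_mul, Matrix.mul_smul, Matrix.smul_mul, this, smul_smul]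
  simp only [mul_neg, neg_mul, mul_one, one_mul, neg_neg]
  module

lemma IsRotation.conj_halfTurn {P : Mat3} (hP : IsRotation P) (e : Vec3) :
    P * halfTurn e * Pᵀ = halfTurn (P *ᵥ e) := by
  simp only [halfTurn, mul_add, add_mul, Matrix.mul_smul, Matrix.smul_mul, mul_tensor, tensor_mul,
    Matrix.transpose_transpose, mul_neg, neg_mul, mul_one, (isRotation_iff.mp hP).2.1]

lemma IsTwinAxis.conj {P U V : Mat3} (hP : IsRotation P) {m : Vec3} (h : IsTwinAxis U V m) :
    IsTwinAxis (P * U * Pᵀ) (P * V * Pᵀ) (P *ᵥ m) := by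
  refine ⟨by rw [IsUnitVec, hP.dotProduct_mulVec]; exact h.1, ?_⟩
  rw [← hP.conj_halfTurn, h.2]
  simp only [Matrix.mul_assoc, hP.mul_cancel]

lemma IsUniqueTwinAxis.conj {P U V : Mat3} (hP : IsRotation P) {m : Vec3}
    (h : IsUniqueTwinAxis U V m) : IsUniqueTwinAxis (P * U * Pᵀ) (P * V * Pᵀ) (P *ᵥ m) := by
  refine ⟨fun h0 => h.ne ?_, h.axis.conj hP, fun e he => ?_⟩
  · rw [← hP.conj_conj U, h0, hP.conj_conj]
  · have := he.conj hP.transpose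
    rw [Matrix.transpose_transpose, hP.conj_conj, hP.conj_conj] at this
    rcases h.unique _ this with h | h
    · left; rw [← h, hP.mulVec_cancel']
    · right; rw [← Matrix.mulVec_neg, ← h, hP.mulVec_cancel']

/-- An axially symmetric matrix has a second twin axis orthogonal to the given one. -/
lemma IsUniqueTwinAxis.ne_smul_one_add {U V : Mat3} {m : Vec3} (h : IsUniqueTwinAxis U V m)
    (α β : ℝ) (u : Vec3) : U ≠ α • (1 : Mat3) + β • tensor u u := by
  rintro rfl
  have hm : m ⬝ᵥ m = 1 := h.axis.1
  have hconj : ∀ {e : Vec3}, IsUnitVec e →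
      halfTurn e * (α • (1 : Mat3) + β • tensor u u) * halfTurn e =
        α • (1 : Mat3) + β • tensor (halfTurn e *ᵥ u) (halfTurn e *ᵥ u) := by
    intro e he
    simp only [mul_add, add_mul, Matrix.mul_smul, Matrix.smul_mul, mul_one, halfTurn_mul_self he,
      mul_tensor, tensor_mul, transpose_halfTurn]
  set w : Vec3 := u - (m ⬝ᵥ u) • m with hw
  have hmw : m ⬝ᵥ w = 0 := by
    rw [hw, dotProduct_sub, dotProduct_smul, hm]; simp
  have hwu : w ⬝ᵥ u = w ⬝ᵥ w := by
    conv_rhs => rw [hw, dotProduct_sub, ← hw, dotProduct_smul, dotProduct_comm w m, hmw]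
    simp
  have hHm : halfTurn m *ᵥ u = -(u - (2 : ℝ) • (m ⬝ᵥ u) • m) := by
    rw [halfTurn_mulVec, smul_smul]; abel
  by_cases hw0 : w = 0
  · apply h.ne
    -- If `u` is parallel to `m`, the half turn about `m` fixes `U` and the two variants coincide.
    have hu : u = (m ⬝ᵥ u) • m := sub_eq_zero.mp hw0
    have : halfTurn m *ᵥ u = u := by
      rw [hHm, ← hu, two_smul]; abel
    rw [h.axis.2, hconj h.axis.1, this]
  · have hpos := dotProduct_self_pos hw0
    set r := Real.sqrt (w ⬝ᵥ w) with hr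
    have hr0 : r ≠ 0 := (Real.sqrt_pos.mpr hpos).ne'
    have hr2 : r * r = w ⬝ᵥ w := Real.mul_self_sqrt hpos.le
    have he : IsUnitVec (r⁻¹ • w) := by
      simp only [IsUnitVec, smul_dotProduct, dotProduct_smul, smul_eq_mul, ← hr2]
      field_simp
    -- The vector `u` lies in the plane of `m` and `w`, which are orthogonal; the half turns about
    -- them therefore send `u` to opposite vectors, and `u ⊗ u` does not see the sign.
    have hHe : halfTurn (r⁻¹ • w) *ᵥ u = -(halfTurn m *ᵥ u) := by
      rw [hHm, halfTurn_mulVec, smul_dotProduct, hwu, ← hr2, smul_smul]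
      have : 2 * (r⁻¹ • (r * r)) * r⁻¹ = 2 := by
        simp only [smul_eq_mul]; field_simp
      rw [this, hw]
      module
    have hax : IsTwinAxis (α • (1 : Mat3) + β • tensor u u) V (r⁻¹ • w) := by
      refine ⟨he, ?_⟩
      rw [h.axis.2, hconj h.axis.1, hconj he, hHe]
      congr 2
      ext i j; simp [tensor_apply]
    have h0 : m ⬝ᵥ (r⁻¹ • w) = 0 := by rw [dotProduct_smul, hmw, smul_zero]
    rcases h.unique _ hax with h' | h' <;> rw [h'] at h0
    · rw [hm] at h0; norm_num at h0
    · rw [dotProduct_neg, hm] at h0; norm_num at h0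

/-- Equality would make `U - d` a matrix of rank one, so `U` would be axially symmetric and its twin
axis would not be unique. -/
lemma IsUniqueTwinAxis.simple_eigenvalue {a b c d : ℝ} (hb : b ≠ 0) {k : Fin 12} {V : Mat3}
    {m : Vec3} (h : IsUniqueTwinAxis (cubicMonoclinic a b c d k) V m) :
    (a - d) * (c - d) ≠ b ^ 2 := by
  intro h0
  obtain ⟨P, hP, hk⟩ := exists_cubicMonoclinic_eq a b c d k
  have had : a - d ≠ 0 := by
    intro h1; rw [h1, zero_mul] at h0; exact hb (pow_eq_zero_iff (two_ne_zero) |>.mp h0.symm)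
  have h' := h.conj hP.1.transpose
  rw [Matrix.transpose_transpose, hk, hP.1.conj_conj] at h'
  refine h'.ne_smul_one_add d (a - d)⁻¹ ![a - d, b, 0] ?_
  have hc : c = d + (a - d)⁻¹ * (b * b) := by field_simp; linarith
  ext i j
  fin_cases i <;> fin_cases j <;> simp [blockMatrix, tensor_apply] <;> first | exact hc | field_simp
  ring

/-- The half turn sends the monoclinic axis `e₃` of the first variant to that of `V`, a coordinate
axis. If this is another axis, `m` bisects the two lines. If it is `e₃` again, either `m` is
parallel to `e₃` and `V = U`, or `m` is orthogonal to `e₃` and a second twin axis exists. -/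
lemma twinAxis_blockMatrix {a b c d : ℝ} (hne : (a - d) * (c - d) ≠ b ^ 2) {V : Mat3}
    (hV : V ∈ Set.range (cubicMonoclinic a b c d)) {m : Vec3}
    (h : IsUniqueTwinAxis (blockMatrix a b c d) V m) :
    2 * m 2 ^ 2 = 1 ∧ ((m 0 = 0 ∧ m 1 ^ 2 = m 2 ^ 2) ∨ (m 1 = 0 ∧ m 0 ^ 2 = m 2 ^ 2)) := by
  have hunit : m 0 * m 0 + m 1 * m 1 + m 2 * m 2 = 1 := by
    have := h.axis.1
    simpa [IsUnitVec, dotProduct, Fin.sum_univ_three] using this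
  have hVm := h.axis.2
  have hNz : blockMatrix a b c d *ᵥ Pi.single 2 1 = d • Pi.single 2 1 := by
    ext i; fin_cases i <;> simp [blockMatrix]
  have hx : V *ᵥ (halfTurn m *ᵥ Pi.single 2 1) = d • (halfTurn m *ᵥ Pi.single 2 1) := by
    rw [hVm, Matrix.mulVec_mulVec, Matrix.mul_assoc _ (halfTurn m), halfTurn_mul_self h.axis.1,
      mul_one, ← Matrix.mulVec_mulVec, hNz, Matrix.mulVec_smul]
  obtain ⟨k, hk⟩ := exists_axis_of_eigenvector hne hV hx
  have hHe : halfTurn m *ᵥ Pi.single 2 1 =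
      ![2 * m 2 * m 0, 2 * m 2 * m 1, 2 * m 2 * m 2 - 1] := by
    rw [halfTurn_mulVec]
    ext i; fin_cases i <;> simp
  rw [hHe] at hk
  have hk0 := hk 0
  have hk1 := hk 1
  have hk2 := hk 2
  fin_cases k
  · simp at hk0 hk1 hk2
    have h1 : m 1 = 0 := by
      rcases hk1 with h | h
      · rw [h] at hk2; norm_num at hk2
      · exact h
    exact ⟨by nlinarith, .inr ⟨h1, by rw [h1] at hunit; nlinarith⟩⟩
  · simp at hk0 hk1 hk2
    have h1 : m 0 = 0 := by
      rcases hk0 with h | h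
      · rw [h] at hk2; norm_num at hk2
      · exact h
    exact ⟨by nlinarith, .inl ⟨h1, by rw [h1] at hunit; nlinarith⟩⟩
  · simp at hk0 hk1
    exfalso
    by_cases h2 : m 2 = 0
    · have hu : m 0 * m 0 + m 1 * m 1 = 1 := by rw [h2] at hunit; linarith
      have hm : m = ![m 0, m 1, 0] := by
        ext i; fin_cases i <;> simp [h2]
      -- The half turns about `m` and about its perpendicular in the plane differ by the half turn
      -- about `e₃`, which commutes with the block matrix.
      have hax : IsTwinAxis (blockMatrix a b c d) V ![-m 1, m 0, 0] := by
        refine ⟨by simp [IsUnitVec, dotProduct, Fin.sum_univ_three]; linarith, ?_⟩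
        have hH : halfTurn ![-m 1, m 0, 0] =
            !![-(2 * (m 0 * m 0) - 1), -(2 * (m 0 * m 1)), 0;
              -(2 * (m 0 * m 1)), -(2 * (m 1 * m 1) - 1), 0; 0, 0, -1] := by
          ext i j; fin_cases i <;> fin_cases j <;> simp [halfTurn, tensor_apply] <;> linarith
        have hH' : halfTurn m =
            !![2 * (m 0 * m 0) - 1, 2 * (m 0 * m 1), 0;
              2 * (m 0 * m 1), 2 * (m 1 * m 1) - 1, 0; 0, 0, -1] := by
          ext i j; fin_cases i <;> fin_cases j <;> simp [halfTurn, tensor_apply, h2] <;> ring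
        rw [hVm, hH, hH', blockMatrix]
        ext i j; fin_cases i <;> fin_cases j <;>
          simp [Matrix.mul_apply, Fin.sum_univ_three] <;> ring
      rcases h.unique _ hax with h' | h'
      · have e0 := congrFun h' 0
        have e1 := congrFun h' 1
        simp at e0 e1
        rw [e1] at e0
        have : m 1 = 0 := by linarith
        rw [e1, this] at hu; norm_num at hu
      · have e0 := congrFun h' 0
        have e1 := congrFun h' 1
        simp at e0 e1
        have : m 0 = 0 := by linarith
        rw [e0, this] at hu; norm_num at hu
    · have h0 : m 0 = 0 := by rcases hk0 with h | h <;> [exact absurd h h2; exact h]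
      have h1 : m 1 = 0 := by rcases hk1 with h | h <;> [exact absurd h h2; exact h]
      have hu : m 2 * m 2 = 1 := by rw [h0, h1] at hunit; linarith
      apply h.ne
      have hH' : halfTurn m = !![-1, 0, 0; 0, -1, 0; 0, 0, 1] := by
        ext i j; fin_cases i <;> fin_cases j <;> simp [halfTurn, tensor_apply, h0, h1, hu]
        norm_num
      rw [hVm, hH', blockMatrix]
      ext i j; fin_cases i <;> fin_cases j <;> simp [Matrix.mul_apply, Fin.sum_univ_three]

/-- The eight possible axes are related by cubic rotations that keep the line of `e₃`; these may
exchange `a` with `c` and change the sign of `b`, which the later criteria do not detect. -/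
lemma exists_normal_form {a b c d : ℝ} (hne : (a - d) * (c - d) ≠ b ^ 2) {i j : Fin 12} {m : Vec3}
    (h : IsUniqueTwinAxis (cubicMonoclinic a b c d i) (cubicMonoclinic a b c d j) m) :
    ∃ (P : Mat3) (a' b' c' η : ℝ), IsCubicRotation P ∧ b' ^ 2 = b ^ 2 ∧
      ((a' = a ∧ c' = c) ∨ (a' = c ∧ c' = a)) ∧ 2 * η ^ 2 = 1 ∧
      cubicMonoclinic a b c d i = P * blockMatrix a' b' c' d * Pᵀ ∧ m = P *ᵥ ![0, η, η] := by
  obtain ⟨P, hP, hk⟩ := exists_cubicMonoclinic_eq a b c d i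
  have h' := h.conj hP.1.transpose
  rw [Matrix.transpose_transpose, hk, hP.1.conj_conj] at h'
  have hV : Pᵀ * cubicMonoclinic a b c d j * P ∈ Set.range (cubicMonoclinic a b c d) := by
    have := conj_mem_range (a := a) (b := b) (c := c) (d := d) hP.transpose ⟨j, rfl⟩
    rwa [Matrix.transpose_transpose] at this
  obtain ⟨h2, hcase⟩ := twinAxis_blockMatrix hne hV h'
  set v := Pᵀ *ᵥ m with hv
  have hm : m = P *ᵥ v := by rw [hv, hP.1.mulVec_cancel']
  have key : ∀ (S : Mat3) (a' b' c' : ℝ), IsSignedPermutation S → b' ^ 2 = b ^ 2 →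
      ((a' = a ∧ c' = c) ∨ (a' = c ∧ c' = a)) →
      blockMatrix a b c d = S * blockMatrix a' b' c' d * Sᵀ → v = S *ᵥ ![0, v 2, v 2] →
      ∃ (P : Mat3) (a' b' c' η : ℝ), IsCubicRotation P ∧ b' ^ 2 = b ^ 2 ∧
      ((a' = a ∧ c' = c) ∨ (a' = c ∧ c' = a)) ∧ 2 * η ^ 2 = 1 ∧
      cubicMonoclinic a b c d i = P * blockMatrix a' b' c' d * Pᵀ ∧ m = P *ᵥ ![0, η, η] := by
    intro S a' b' c' hS hb' hac hB hvS
    refine ⟨P * S, a', b', c', v 2, hP.mul hS.isCubicRotation, hb', hac, h2, ?_, ?_⟩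
    · rw [hk, hB, Matrix.transpose_mul]; simp only [Matrix.mul_assoc]
    · rw [← Matrix.mulVec_mulVec, ← hvS, hm]
  rcases hcase with ⟨h0, h1⟩ | ⟨h0, h1⟩ <;> rcases sq_eq_sq_iff_eq_or_eq_neg.mp h1 with h1 | h1
  · refine key _ a b c ⟨1, 1, 1, by simp, by simp, by simp, .inl ⟨by norm_num, .inl rfl⟩⟩ rfl
      (.inl ⟨rfl, rfl⟩) ?_ ?_
    · ext i j; fin_cases i <;> fin_cases j <;>
        simp [blockMatrix, Matrix.mul_apply, Fin.sum_univ_three]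
    · ext i; fin_cases i <;> simp [Matrix.mulVec, dotProduct, Fin.sum_univ_three, h0, h1]
  · refine key _ a b c ⟨-1, -1, 1, by simp, by simp, by simp, .inl ⟨by norm_num, .inl rfl⟩⟩ rfl
      (.inl ⟨rfl, rfl⟩) ?_ ?_
    · ext i j; fin_cases i <;> fin_cases j <;>
        simp [blockMatrix, Matrix.mul_apply, Fin.sum_univ_three]
    · ext i; fin_cases i <;> simp [Matrix.mulVec, dotProduct, Fin.sum_univ_three, h0, h1]
  · refine key _ c (-b) a ⟨1, -1, 1, by simp, by simp, by simp,
      .inr ⟨by norm_num, .inr (.inr rfl)⟩⟩ (neg_sq b) (.inr ⟨rfl, rfl⟩) ?_ ?_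
    · ext i j; fin_cases i <;> fin_cases j <;>
        simp [blockMatrix, Matrix.mul_apply, Fin.sum_univ_three]
    · ext i; fin_cases i <;> simp [Matrix.mulVec, dotProduct, Fin.sum_univ_three, h0, h1]
  · refine key _ c (-b) a ⟨-1, 1, 1, by simp, by simp, by simp,
      .inr ⟨by norm_num, .inr (.inr rfl)⟩⟩ (neg_sq b) (.inr ⟨rfl, rfl⟩) ?_ ?_
    · ext i j; fin_cases i <;> fin_cases j <;>
        simp [blockMatrix, Matrix.mul_apply, Fin.sum_univ_three]
    · ext i; fin_cases i <;> simp [Matrix.mulVec, dotProduct, Fin.sum_univ_three, h0, h1]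

/-- In the normal form the second matrix has the monoclinic axis `P e₂`. -/
lemma IsTwinAxis.mulVec_second {P V : Mat3} {a b c d η : ℝ} (hP : IsRotation P)
    (hη : 2 * η ^ 2 = 1)
    (h : IsTwinAxis (P * blockMatrix a b c d * Pᵀ) V (P *ᵥ ![0, η, η])) :
    V *ᵥ (P *ᵥ Pi.single 1 1) = d • (P *ᵥ Pi.single 1 1) := by
  have h12 : halfTurn (P *ᵥ ![0, η, η]) *ᵥ (P *ᵥ Pi.single 1 1) = P *ᵥ Pi.single 2 1 := by
    rw [halfTurn_mulVec, hP.dotProduct_mulVec, ← Matrix.mulVec_smul, ← Matrix.mulVec_sub]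
    congr 1
    ext i; fin_cases i <;> simp [dotProduct, Fin.sum_univ_three] <;> nlinarith
  have h21 : halfTurn (P *ᵥ ![0, η, η]) *ᵥ (P *ᵥ Pi.single 2 1) = P *ᵥ Pi.single 1 1 := by
    rw [← h12, Matrix.mulVec_mulVec, halfTurn_mul_self h.1, Matrix.one_mulVec]
  rw [h.2, ← Matrix.mulVec_mulVec, h12, ← Matrix.mulVec_mulVec, ← Matrix.mulVec_mulVec,
    hP.mulVec_cancel, ← Matrix.mulVec_mulVec]
  have hNz : blockMatrix a b c d *ᵥ Pi.single 2 1 = d • Pi.single 2 1 := by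
    ext i; fin_cases i <;> simp [blockMatrix]
  rw [hNz, Matrix.mulVec_smul, Matrix.mulVec_smul, h21]

/-! ### Cubic rotations preserving a line -/

lemma IsOrbitFamily.comp {a n : Vec3} {k l : ℕ} {Q : Fin k → Mat3} (h : IsOrbitFamily a n Q)
    {f : Fin l → Fin k} (hf : Function.Injective f) : IsOrbitFamily a n (Q ∘ f) :=
  ⟨h.injective.comp hf, fun _ => h.cubic _, fun _ => h.ne_one _, fun _ => h.normal _,
    fun _ _ hij => h.indep _ _ (hf.ne hij),
    fun _ _ _ hij hil hjl => h.indep_triple _ _ _ (hf.ne hij) (hf.ne hil) (hf.ne hjl)⟩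

/-- `(p, q, r)` is parallel to a vector of one of the types `⟨1 0 0⟩`, `⟨1 1 0⟩`, `⟨1 1 1⟩`. -/
def IsSpecialDirection (p q r : ℝ) : Prop :=
  (p = 0 ∧ q = 0) ∨ (p = 0 ∧ r = 0) ∨ (q = 0 ∧ r = 0) ∨
  (p = 0 ∧ q ^ 2 = r ^ 2) ∨ (q = 0 ∧ p ^ 2 = r ^ 2) ∨ (r = 0 ∧ p ^ 2 = q ^ 2) ∨
  (p ^ 2 = q ^ 2 ∧ q ^ 2 = r ^ 2)

/-- A nontrivial cubic rotation fixing a line that is not special is a half turn about an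
orthogonal axis. -/
lemma IsCubicRotation.eq_of_normal {Q : Mat3} (hQ : IsCubicRotation Q) (h1 : Q ≠ 1) {p q r : ℝ}
    (hs : ¬ IsSpecialDirection p q r)
    (hn : Q *ᵥ ![p, q, r] = ![p, q, r] ∨ Q *ᵥ ![p, q, r] = -![p, q, r]) :
    (p = 0 ∧ Q = !![1, 0, 0; 0, -1, 0; 0, 0, -1]) ∨
    (q = 0 ∧ Q = !![-1, 0, 0; 0, 1, 0; 0, 0, -1]) ∨
    (r = 0 ∧ Q = !![-1, 0, 0; 0, -1, 0; 0, 0, 1]) ∨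
    (q = -r ∧ Q = !![-1, 0, 0; 0, 0, 1; 0, 1, 0]) ∨
    (q = r ∧ Q = !![-1, 0, 0; 0, 0, -1; 0, -1, 0]) ∨
    (p = -r ∧ Q = !![0, 0, 1; 0, -1, 0; 1, 0, 0]) ∨
    (p = r ∧ Q = !![0, 0, -1; 0, -1, 0; -1, 0, 0]) ∨
    (p = -q ∧ Q = !![0, 1, 0; 1, 0, 0; 0, 0, -1]) ∨
    (p = q ∧ Q = !![0, -1, 0; -1, 0, 0; 0, 0, -1]) := by
  unfold IsSpecialDirection at hs
  have key : ∃ σ : ℝ, (σ = 1 ∨ σ = -1) ∧ Q *ᵥ ![p, q, r] = ![σ * p, σ * q, σ * r] := by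
    rcases hn with h | h
    · exact ⟨1, .inl rfl, by simpa using h⟩
    · exact ⟨-1, .inr rfl, by simpa using h⟩
  clear hn
  obtain ⟨σ, hσ, hn⟩ := key
  have e0 := congrFun hn 0
  have e1 := congrFun hn 1
  have e2 := congrFun hn 2
  clear hn
  obtain ⟨x, y, z, hx, hy, hz, ⟨hd, rfl | rfl | rfl⟩ | ⟨hd, rfl | rfl | rfl⟩⟩ :=
    hQ.isSignedPermutation <;>
    simp [Matrix.mulVec, dotProduct, Fin.sum_univ_three] at e0 e1 e2
  · rcases hx with rfl | rfl <;> rcases hy with rfl | rfl <;> rcases hz with rfl | rfl <;>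
      norm_num at hd
    · exact absurd Matrix.one_fin_three.symm h1
    · exact .inl ⟨by grind, rfl⟩
    · exact .inr (.inl ⟨by grind, rfl⟩)
    · exact .inr (.inr (.inl ⟨by grind, rfl⟩))
  -- The two cyclic shapes have order three, and their only invariant line is of type ⟨1 1 1⟩.
  · exact absurd (by grind) hs
  · exact absurd (by grind) hs
  · rcases hx with rfl | rfl <;> rcases hy with rfl | rfl <;> rcases hz with rfl | rfl <;>
      norm_num at hd
    · exact absurd (by grind) hs
    · exact absurd (by grind) hs
    · exact .inr (.inr (.inr (.inl ⟨by grind, rfl⟩)))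
    · exact .inr (.inr (.inr (.inr (.inl ⟨by grind, rfl⟩))))
  · rcases hx with rfl | rfl <;> rcases hy with rfl | rfl <;> rcases hz with rfl | rfl <;>
      norm_num at hd
    · exact absurd (by grind) hs
    · exact .inr (.inr (.inr (.inr (.inr (.inl ⟨by grind, rfl⟩)))))
    · exact absurd (by grind) hs
    · exact .inr (.inr (.inr (.inr (.inr (.inr (.inl ⟨by grind, rfl⟩))))))
  · rcases hx with rfl | rfl <;> rcases hy with rfl | rfl <;> rcases hz with rfl | rfl <;>
      norm_num at hd
    · exact .inr (.inr (.inr (.inr (.inr (.inr (.inr (.inl ⟨by grind, rfl⟩)))))))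
    · exact absurd (by grind) hs
    · exact absurd (by grind) hs
    · exact .inr (.inr (.inr (.inr (.inr (.inr (.inr (.inr ⟨by grind, rfl⟩)))))))

/-- Away from special directions, each rotation confines `n` to one of the nine planes orthogonal to
a twofold axis, and two different planes of this kind meet in a special line. -/
lemma isSpecialDirection_of_pair {Q Q' : Mat3} (hQ : IsCubicRotation Q) (hQ' : IsCubicRotation Q')
    (h1 : Q ≠ 1) (h1' : Q' ≠ 1) (hne : Q ≠ Q') {p q r : ℝ}
    (hn : Q *ᵥ ![p, q, r] = ![p, q, r] ∨ Q *ᵥ ![p, q, r] = -![p, q, r])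
    (hn' : Q' *ᵥ ![p, q, r] = ![p, q, r] ∨ Q' *ᵥ ![p, q, r] = -![p, q, r]) :
    IsSpecialDirection p q r := by
  by_contra hs
  have h := hQ.eq_of_normal h1 hs hn
  have h' := hQ'.eq_of_normal h1' hs hn'
  clear hn hn' h1 h1' hQ hQ'
  unfold IsSpecialDirection at hs
  rcases h with ⟨e, h⟩ | ⟨e, h⟩ | ⟨e, h⟩ | ⟨e, h⟩ | ⟨e, h⟩ | ⟨e, h⟩ | ⟨e, h⟩ | ⟨e, h⟩ | ⟨e, h⟩ <;>
  rcases h' with ⟨e', h'⟩ | ⟨e', h'⟩ | ⟨e', h'⟩ | ⟨e', h'⟩ | ⟨e', h'⟩ | ⟨e', h'⟩ | ⟨e', h'⟩ |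
    ⟨e', h'⟩ | ⟨e', h'⟩ <;>
  first
  | exact hne (h.trans h'.symm)
  | (clear h h' hne; grind)

lemma cross_dotProduct_eq_zero {u v w f : Vec3} (hf : f ≠ 0) (hu : u ⬝ᵥ f = 0) (hv : v ⬝ᵥ f = 0)
    (hw : w ⬝ᵥ f = 0) : crossProduct u v ⬝ᵥ w = 0 := by
  obtain ⟨i, hi⟩ := Function.ne_iff.mp hf
  apply mul_left_cancel₀ hi
  simp only [dotProduct, Fin.sum_univ_three] at hu hv hw
  simp only [dotProduct, Fin.sum_univ_three, cross_apply]
  fin_cases i <;> simp <;> grind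

/-- A family with at least two members requires that `a` is not orthogonal to `n`. -/
lemma IsOrbitFamily.dotProduct_ne_zero {a n : Vec3} {Q : Fin 2 → Mat3} (h : IsOrbitFamily a n Q)
    (hn : n ≠ 0) : a ⬝ᵥ n ≠ 0 := by
  intro h0
  -- Each rotation preserves the plane orthogonal to `n`, so all images of `a` stay in it.
  have key : ∀ i, (Q i *ᵥ a) ⬝ᵥ n = 0 := by
    intro i
    have h1 := (h.cubic i).1.dotProduct_mulVec a n
    rcases h.normal i with h' | h' <;> rw [h'] at h1
    · rw [h1, h0]
    · rw [dotProduct_neg, h0] at h1; linarith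
  exact h.indep 0 1 (by decide) (cross_dotProduct_eq_zero hn (key 0) (key 1) h0)

/-- If the rotations considered move the line of `v 0` to at most three lines, there is no family
with three members. -/
lemma not_isOrbitFamily_three {n : Vec3} (v : Fin 3 → Vec3)
    (hv : ∀ Q, IsCubicRotation Q → (Q *ᵥ n = n ∨ Q *ᵥ n = -n) →
      ∃ (k : Fin 3) (s : ℝ), Q *ᵥ v 0 = s • v k) (Q : Fin 3 → Mat3) :
    ¬ IsOrbitFamily (v 0) n Q := by
  intro h
  choose k s hk using fun i => hv (Q i) (h.cubic i) (h.normal i)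
  -- Images on a common line are dependent, so the three images occupy all three lines, including
  -- that of `v 0` itself.
  have hinj : Function.Injective k := by
    intro i j hij
    by_contra hne
    apply h.indep i j hne
    rw [hk, hk, hij]
    simp
  obtain ⟨i, hi⟩ := Finite.surjective_of_injective hinj 0
  have : ∃ j, i ≠ j := by clear * -; revert i; decide
  obtain ⟨j, hj⟩ := this
  apply h.indep i j hj
  rw [hk i, hi]
  simp [dotProduct_comm _ (v 0)]

/-- Up to the common sign `σ`, the signs in `Q` are compatible with `(e0, e1, e2)`, so `Q` merely
moves the exceptional weight `u` to another coordinate. -/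
lemma mulVec_eq_smul_of_diagonal_normal {e0 e1 e2 u w : ℝ} {Q : Mat3} (hQ : IsCubicRotation Q)
    (hn : Q *ᵥ ![e0, e1, e2] = ![e0, e1, e2] ∨ Q *ᵥ ![e0, e1, e2] = -![e0, e1, e2]) :
    ∃ (k : Fin 3) (s : ℝ), Q *ᵥ ![e0 * u, e1 * w, e2 * w] =
      s • (![![e0 * u, e1 * w, e2 * w], ![e0 * w, e1 * u, e2 * w], ![e0 * w, e1 * w, e2 * u]] :
        Fin 3 → Vec3) k := by
  have key : ∃ σ : ℝ, Q *ᵥ ![e0, e1, e2] = ![σ * e0, σ * e1, σ * e2] := by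
    rcases hn with h | h
    · exact ⟨1, by simpa using h⟩
    · exact ⟨-1, by simpa using h⟩
  clear hn
  obtain ⟨σ, hn⟩ := key
  have h0 := congrFun hn 0
  have h1 := congrFun hn 1
  have h2 := congrFun hn 2
  clear hn
  obtain ⟨x, y, z, hx, hy, hz, ⟨hd, rfl | rfl | rfl⟩ | ⟨hd, rfl | rfl | rfl⟩⟩ :=
    hQ.isSignedPermutation <;>
    simp [Matrix.mulVec, dotProduct, Fin.sum_univ_three] at h0 h1 h2
  · exact ⟨0, σ, by ext i; fin_cases i <;> simp [Matrix.mulVec, dotProduct, Fin.sum_univ_three] <;>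
      grind⟩
  · exact ⟨2, σ, by ext i; fin_cases i <;> simp [Matrix.mulVec, dotProduct, Fin.sum_univ_three] <;>
      grind⟩
  · exact ⟨1, σ, by ext i; fin_cases i <;> simp [Matrix.mulVec, dotProduct, Fin.sum_univ_three] <;>
      grind⟩
  · exact ⟨0, σ, by ext i; fin_cases i <;> simp [Matrix.mulVec, dotProduct, Fin.sum_univ_three] <;>
      grind⟩
  · exact ⟨2, σ, by ext i; fin_cases i <;> simp [Matrix.mulVec, dotProduct, Fin.sum_univ_three] <;>
      grind⟩
  · exact ⟨1, σ, by ext i; fin_cases i <;> simp [Matrix.mulVec, dotProduct, Fin.sum_univ_three] <;>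
      grind⟩

lemma not_isOrbitFamily_three_of_diagonal {e0 e1 e2 u w : ℝ} (Q : Fin 3 → Mat3) :
    ¬ IsOrbitFamily ![e0 * u, e1 * w, e2 * w] ![e0, e1, e2] Q :=
  not_isOrbitFamily_three
    ![![e0 * u, e1 * w, e2 * w], ![e0 * w, e1 * u, e2 * w], ![e0 * w, e1 * w, e2 * u]]
    (fun _ hQ hn => mulVec_eq_smul_of_diagonal_normal hQ hn) Q

/-- The two rotations of order three about `(ε, 1, -1)` permute the weights `(u, w, w)` cyclically.
Independence is the nonvanishing of a circulant determinant, `(u - w)² (u + 2w)` up to sign. -/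
lemma exists_isOrbitFamily_two {ε u w y : ℝ} (hε : ε = 1 ∨ ε = -1) (huw : u ≠ w)
    (huw' : u + 2 * w ≠ 0) :
    ∃ Q : Fin 2 → Mat3, IsOrbitFamily ![ε * u, w, -w] ![ε * y, y, -y] Q := by
  have hε2 : ε * ε = 1 := by rcases hε with rfl | rfl <;> norm_num
  have hε' : -ε = 1 ∨ -ε = -1 := by rcases hε with rfl | rfl <;> norm_num
  have hne : (u - w) ^ 2 * (u + 2 * w) * ε ≠ 0 := by
    refine mul_ne_zero (mul_ne_zero (pow_ne_zero 2 (sub_ne_zero.mpr huw)) huw') ?_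
    rintro rfl; norm_num at hε2
  refine ⟨![!![0, ε, 0; 0, 0, -1; -ε, 0, 0], !![0, 0, -ε; ε, 0, 0; 0, -1, 0]], ?_, ?_, ?_, ?_, ?_,
    ?_⟩
  · have h01 : (!![0, ε, 0; 0, 0, -1; -ε, 0, 0] : Mat3) ≠ !![0, 0, -ε; ε, 0, 0; 0, -1, 0] := by
      intro h
      have := congrFun (congrFun h 1) 2
      simp at this
    intro i j hij
    fin_cases i <;> fin_cases j
    · rfl
    · exact absurd hij h01
    · exact absurd hij.symm h01
    · rfl
  · intro i
    apply IsSignedPermutation.isCubicRotation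
    fin_cases i
    · exact ⟨ε, -1, -ε, hε, by simp, hε', .inl ⟨by linarith, .inr (.inl rfl)⟩⟩
    · exact ⟨-ε, ε, -1, hε', hε, by simp, .inl ⟨by linarith, .inr (.inr rfl)⟩⟩
  · intro i h
    have := congrFun (congrFun h 0) 0
    fin_cases i <;> simp at this
  · intro i
    left
    fin_cases i <;> ext j <;> fin_cases j <;>
      simp [Matrix.mulVec, dotProduct, Fin.sum_univ_three, ← mul_assoc, hε2]
  · intro i j hij h
    apply hne
    fin_cases i <;> fin_cases j <;> simp at hij <;>
      simp [dotProduct, Fin.sum_univ_three, cross_apply] at h <;> grind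
  · intro i j l hij hil hjl
    fin_cases i <;> fin_cases j <;> fin_cases l <;> simp at hij hil hjl

/-- The rotations are the half turns about `e₂`, `(1, 0, ε)` and `(1, 0, -ε)`, which with the
identity form a group; any three of the four images of `(r, 1, -1)` are dependent only if `r² = 1`.
-/
lemma exists_isOrbitFamily_three {ε r x : ℝ} (hε : ε = 1 ∨ ε = -1) (hr : r ^ 2 ≠ 1) :
    (∃ Q : Fin 3 → Mat3, IsOrbitFamily ![r, 1, -1] ![x, 0, ε * x] Q) := by
  refine ⟨![!![-1, 0, 0; 0, 1, 0; 0, 0, -1], !![0, 0, ε; 0, -1, 0; ε, 0, 0],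
    !![0, 0, -ε; 0, -1, 0; -ε, 0, 0]], ?_, ?_, ?_, ?_, ?_, ?_⟩
  · intro i j hij
    have h1 := congrFun (congrFun hij 1) 1
    have h2 := congrFun (congrFun hij 0) 2
    rcases hε with rfl | rfl <;> fin_cases i <;> fin_cases j <;> simp at h1 h2 ⊢ <;>
      norm_num at h1 h2
  · intro i
    apply IsSignedPermutation.isCubicRotation
    rcases hε with rfl | rfl <;> fin_cases i
    · exact ⟨-1, 1, -1, by simp, by simp, by simp, .inl ⟨by norm_num, .inl rfl⟩⟩
    · exact ⟨1, -1, 1, by simp, by simp, by simp, .inr ⟨by norm_num, .inr (.inl rfl)⟩⟩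
    · exact ⟨-1, -1, -1, by simp, by simp, by simp, .inr ⟨by norm_num, .inr (.inl rfl)⟩⟩
    · exact ⟨-1, 1, -1, by simp, by simp, by simp, .inl ⟨by norm_num, .inl rfl⟩⟩
    · exact ⟨-1, -1, -1, by simp, by simp, by simp, .inr ⟨by norm_num, .inr (.inl rfl)⟩⟩
    · exact ⟨1, -1, 1, by simp, by simp, by simp,
        .inr ⟨by norm_num, .inr (.inl (by simp))⟩⟩
  · intro i h
    have := congrFun (congrFun h 0) 0
    fin_cases i <;> simp at this
    norm_num at this
  · intro i
    rcases hε with rfl | rfl <;> fin_cases i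
    · right; ext j; fin_cases j <;> simp [Matrix.mulVec, dotProduct, Fin.sum_univ_three]
    · left; ext j; fin_cases j <;> simp [Matrix.mulVec, dotProduct, Fin.sum_univ_three]
    · right; ext j; fin_cases j <;> simp [Matrix.mulVec, dotProduct, Fin.sum_univ_three]
    · right; ext j; fin_cases j <;> simp [Matrix.mulVec, dotProduct, Fin.sum_univ_three]
    · left; ext j; fin_cases j <;> simp [Matrix.mulVec, dotProduct, Fin.sum_univ_three]
    · right; ext j; fin_cases j <;> simp [Matrix.mulVec, dotProduct, Fin.sum_univ_three]
  · intro i j hij h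
    apply hr
    rcases hε with rfl | rfl <;> fin_cases i <;> fin_cases j <;> simp at hij <;>
      simp [dotProduct, Fin.sum_univ_three, cross_apply] at h <;> linarith
  · intro i j l hij hil hjl h
    apply hr
    rcases hε with rfl | rfl <;> fin_cases i <;> fin_cases j <;> simp at hij <;> fin_cases l <;>
      simp at hil hjl <;>
      simp [dotProduct, Fin.sum_univ_three, cross_apply] at h <;> linarith

/-- The special directions that `n` can have, for the shear vector `(r, 1, -1)`. -/
lemma IsOrbitFamily.normal_cases {δ r t : ℝ} (hδ : 0 < δ) (hδ1 : δ ≠ 1) (hr : r ≠ 0) (ht0 : 0 < t)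
    {Q : Fin 2 → Mat3} (h : IsOrbitFamily ![r, 1, -1] ![r, 1 - t * (1 + δ), δ - t * (1 + δ)] Q) :
    (r ^ 2 = (1 - δ) ^ 2 ∧ r ^ 2 ≠ 1) ∨
      (2 * (1 - t * (1 + δ)) = 1 - δ ∧ 4 * r ^ 2 = (1 - δ) ^ 2 ∧ δ ≠ 5) := by
  have hs := isSpecialDirection_of_pair (h.cubic 0) (h.cubic 1) (h.ne_one 0) (h.ne_one 1)
    (h.injective.ne (by decide)) (h.normal 0) (h.normal 1)
  have hdot := h.dotProduct_ne_zero (fun h0 => hr (by simpa using congrFun h0 0))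
  simp only [dotProduct, Fin.sum_univ_three, Matrix.cons_val] at hdot
  set y := 1 - t * (1 + δ) with hy
  have hz : δ - t * (1 + δ) = y - (1 - δ) := by rw [hy]; ring
  rw [hz] at hs hdot
  have hδ1' : 1 - δ ≠ 0 := sub_ne_zero.mpr (Ne.symm hδ1)
  have hylt : y < 1 := by rw [hy]; nlinarith
  -- The inner product does not depend on `t`, because `(r, 1, -1)` is orthogonal to the twin axis.
  have hdot' : r ^ 2 + (1 - δ) ≠ 0 := fun h0 => hdot (by linear_combination h0)
  rcases hs with ⟨h1, -⟩ | ⟨h1, -⟩ | ⟨h1, h2⟩ | ⟨h1, -⟩ | ⟨h1, h2⟩ | ⟨h1, h2⟩ | ⟨h1, h2⟩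
  · exact absurd h1 hr
  · exact absurd h1 hr
  · rw [h1] at h2; exact absurd (by linarith) hδ1'
  · exact absurd h1 hr
  · left
    have h3 : r ^ 2 = (1 - δ) ^ 2 := by rw [h2, h1]; ring
    refine ⟨h3, fun h4 => ?_⟩
    have : (1 - δ - 1) * (1 - δ + 1) = 0 := by rw [h4] at h3; linear_combination -h3
    rcases mul_eq_zero.mp this with h5 | h5
    · linarith
    · exact hdot' (by rw [h4]; linarith)
  · left
    have h3 : r ^ 2 = (1 - δ) ^ 2 := by rw [h2]; congr 1; linarith
    refine ⟨h3, fun h4 => ?_⟩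
    have : (1 - δ - 1) * (1 - δ + 1) = 0 := by rw [h4] at h3; linear_combination -h3
    rcases mul_eq_zero.mp this with h5 | h5
    · linarith
    · exact hdot' (by rw [h4]; linarith)
  · right
    have h3 : (1 - δ) * (2 * y - (1 - δ)) = 0 := by linear_combination h2
    have h4 : 2 * y = 1 - δ := by
      rcases mul_eq_zero.mp h3 with h3 | h3
      · exact absurd h3 hδ1'
      · linarith
    refine ⟨h4, by rw [h1, ← h4]; ring, fun h5 => ?_⟩
    have h6 : y = -2 := by linarith
    rw [h6] at h1
    exact hdot' (by rw [h1, h5]; norm_num)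

theorem exists_isOrbitFamily_three_iff {δ r : ℝ} (hδ : 0 < δ) (hδ1 : δ ≠ 1) (hr : r ≠ 0) :
    (∃ t : ℝ, 0 < t ∧ t < 1 ∧ ∃ Q : Fin 3 → Mat3,
      IsOrbitFamily ![r, 1, -1] ![r, 1 - t * (1 + δ), δ - t * (1 + δ)] Q) ↔
      r ^ 2 = (1 - δ) ^ 2 ∧ r ^ 2 ≠ 1 := by
  constructor
  · rintro ⟨t, ht0, ht1, Q, hQ⟩
    rcases (hQ.comp (Fin.castSucc_injective 2)).normal_cases hδ hδ1 hr ht0 with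
      h | ⟨h1, h2, h3⟩
    · exact h
    · exfalso
      set y := 1 - t * (1 + δ) with hy
      have hy0 : y ≠ 0 := by
        intro h0; rw [h0] at h1; exact hδ1 (by linarith)
      have hz : δ - t * (1 + δ) = -y := by rw [hy]; linarith
      have hr2 : r ^ 2 = y ^ 2 := by nlinarith
      have := hQ.smul (β := y⁻¹) (one_ne_zero (α := ℝ))
      -- In the ⟨1 1 1⟩ case `n = (r, y, -y)` with `r² = y²`; dividing by `y` exhibits the shear
      -- vector as `n` with weights `(y, 1, 1)`.
      refine not_isOrbitFamily_three_of_diagonal (e0 := r / y) (e1 := 1) (e2 := -1) (u := y)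
        (w := 1) Q ?_
      convert this using 1
      · ext i; fin_cases i <;> simp [hy0]
      · rw [hz]; ext i; fin_cases i <;> simp [hy0, div_eq_inv_mul]
  · rintro ⟨h1, h2⟩
    -- This `t` annihilates the second coordinate of `n`, leaving `(r, 0, δ - 1)`.
    refine ⟨1 / (1 + δ), by positivity, by rw [div_lt_one (by positivity)]; linarith, ?_⟩
    have ht : 1 / (1 + δ) * (1 + δ) = 1 := by field_simp
    rw [ht, sub_self]
    rcases sq_eq_sq_iff_eq_or_eq_neg.mp h1 with h | h
    · have := exists_isOrbitFamily_three (ε := -1) (x := r) (.inr rfl) h2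
      rwa [show -1 * r = δ - 1 by rw [h]; ring] at this
    · have := exists_isOrbitFamily_three (ε := 1) (x := r) (.inl rfl) h2
      rwa [show 1 * r = δ - 1 by rw [h]; ring] at this

theorem exists_isOrbitFamily_two_iff {δ r : ℝ} (hδ : 0 < δ) (hδ1 : δ ≠ 1) (hr : r ≠ 0) :
    (∃ t : ℝ, 0 < t ∧ t < 1 ∧ ∃ Q : Fin 2 → Mat3,
      IsOrbitFamily ![r, 1, -1] ![r, 1 - t * (1 + δ), δ - t * (1 + δ)] Q) ↔
      (r ^ 2 = (1 - δ) ^ 2 ∧ r ^ 2 ≠ 1) ∨ (4 * r ^ 2 = (1 - δ) ^ 2 ∧ δ ≠ 5) := by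
  constructor
  · rintro ⟨t, ht0, ht1, Q, hQ⟩
    rcases hQ.normal_cases hδ hδ1 hr ht0 with h | ⟨-, h⟩
    · exact .inl h
    · exact .inr h
  · rintro (h | ⟨h1, h2⟩)
    · obtain ⟨t, ht0, ht1, Q, hQ⟩ := (exists_isOrbitFamily_three_iff hδ hδ1 hr).mpr h
      exact ⟨t, ht0, ht1, _, hQ.comp (Fin.castSucc_injective 2)⟩
    -- At `t = 1/2` the last two coordinates of `n` are opposite, equal to `±(1 - δ)/2`.
    · refine ⟨1 / 2, by norm_num, by norm_num, ?_⟩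
      have hex : ∃ ε : ℝ, (ε = 1 ∨ ε = -1) ∧ r = ε * ((1 - δ) / 2) := by
        have : r ^ 2 = ((1 - δ) / 2) ^ 2 := by linarith
        rcases sq_eq_sq_iff_eq_or_eq_neg.mp this with h | h
        · exact ⟨1, .inl rfl, by linarith⟩
        · exact ⟨-1, .inr rfl, by linarith⟩
      obtain ⟨ε, hε, h⟩ := hex
      have := exists_isOrbitFamily_two (u := (1 - δ) / 2) (w := 1) (y := (1 - δ) / 2) hε
        (fun h => by linarith) (fun h => h2 (by linarith))
      rw [← h] at this
      convert this using 4
      ring_nf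

/-- Here `ρ = 0` would make `n` orthogonal to the shear, and `0 < t < 1` keeps the other two
coordinates nonzero and of opposite sign; only type ⟨1 1 1⟩ is left. -/
lemma IsOrbitFamily.normal_cases_of_axis {ρ t : ℝ} (ht0 : 0 < t) (ht1 : t < 1)
    {Q : Fin 2 → Mat3} (h : IsOrbitFamily ![1, 0, 0] ![ρ, 1 - t, -t] Q) :
    t = 1 / 2 ∧ 4 * ρ ^ 2 = 1 := by
  have hs := isSpecialDirection_of_pair (h.cubic 0) (h.cubic 1) (h.ne_one 0) (h.ne_one 1)
    (h.injective.ne (by decide)) (h.normal 0) (h.normal 1)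
  have hdot := h.dotProduct_ne_zero (fun h0 => ht0.ne' (by simpa using congrFun h0 2))
  simp [dotProduct, Fin.sum_univ_three] at hdot
  rcases hs with ⟨h1, h2⟩ | ⟨h1, h2⟩ | ⟨h1, h2⟩ | ⟨h1, h2⟩ | ⟨h1, h2⟩ | ⟨h1, h2⟩ | ⟨h1, h2⟩
  · exact absurd h1 hdot
  · exact absurd h1 hdot
  · linarith
  · exact absurd h1 hdot
  · linarith
  · linarith
  · have : t = 1 / 2 := by linarith
    exact ⟨this, by rw [h1, this]; norm_num⟩

theorem not_isOrbitFamily_three_of_axis {ρ t : ℝ} (ht0 : 0 < t) (ht1 : t < 1)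
    {Q : Fin 3 → Mat3} : ¬ IsOrbitFamily ![1, 0, 0] ![ρ, 1 - t, -t] Q := by
  intro hQ
  obtain ⟨ht, hρ⟩ :=
    (hQ.comp (Fin.castSucc_injective 2)).normal_cases_of_axis ht0 ht1
  have := hQ.smul (β := 2) (one_ne_zero (α := ℝ))
  refine not_isOrbitFamily_three_of_diagonal (e0 := 2 * ρ) (e1 := 1) (e2 := -1) (u := 2 * ρ)
    (w := 0) Q ?_
  convert this using 1
  · ext i; fin_cases i <;> simp
    linarith
  · rw [ht]; ext i; fin_cases i <;> norm_num

theorem exists_isOrbitFamily_two_iff_of_axis {ρ : ℝ} :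
    (∃ t : ℝ, 0 < t ∧ t < 1 ∧ ∃ Q : Fin 2 → Mat3,
      IsOrbitFamily ![1, 0, 0] ![ρ, 1 - t, -t] Q) ↔ 4 * ρ ^ 2 = 1 := by
  constructor
  · rintro ⟨t, ht0, ht1, Q, h⟩
    exact (h.normal_cases_of_axis ht0 ht1).2
  · intro h
    refine ⟨1 / 2, by norm_num, by norm_num, ?_⟩
    have hex : ∃ ε : ℝ, (ε = 1 ∨ ε = -1) ∧ ρ = ε * (1 / 2) := by
      have : ρ ^ 2 = (1 / 2) ^ 2 := by linarith
      rcases sq_eq_sq_iff_eq_or_eq_neg.mp this with h | h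
      · exact ⟨1, .inl rfl, by linarith⟩
      · exact ⟨-1, .inr rfl, by linarith⟩
    obtain ⟨ε, hε, h⟩ := hex
    have hε2 : ε * ε = 1 := by rcases hε with rfl | rfl <;> norm_num
    have hε0 : ε ≠ 0 := by rintro rfl; norm_num at hε2
    have := exists_isOrbitFamily_two (u := ε) (w := 0) (y := 1 / 2) hε hε0 (by simpa using hε0)
    rw [← h, hε2, neg_zero] at this
    convert this using 4
    norm_num

/-! ### Covariance of the twin data under rotations -/

lemma IsRotation.adjugate_eq {P : Mat3} (hP : IsRotation P) : P.adjugate = Pᵀ := by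
  obtain ⟨-, h2, h3⟩ := isRotation_iff.mp hP
  calc P.adjugate = P.adjugate * (P * Pᵀ) := by rw [h2, mul_one]
    _ = Pᵀ := by rw [← Matrix.mul_assoc, Matrix.adjugate_mul, h3, one_smul, one_mul]

lemma IsRotation.cofactorMatrix_conj {P : Mat3} (hP : IsRotation P) (A : Mat3) :
    cofactorMatrix (P * A * Pᵀ) = P * cofactorMatrix A * Pᵀ := by
  rw [cofactorMatrix, Matrix.adjugate_mul_distrib, Matrix.adjugate_mul_distrib, hP.adjugate_eq,
    hP.transpose.adjugate_eq, cofactorMatrix, Matrix.transpose_transpose, Matrix.transpose_mul,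
    Matrix.transpose_mul, Matrix.transpose_transpose, Matrix.mul_assoc]

lemma IsRotation.mul_conj {P : Mat3} (hP : IsRotation P) (A B : Mat3) :
    (P * A * Pᵀ) * (P * B * Pᵀ) = P * (A * B) * Pᵀ := by
  simp only [Matrix.mul_assoc, hP.mul_cancel]

lemma IsRotation.one_conj {P : Mat3} (hP : IsRotation P) : P * 1 * Pᵀ = 1 := by
  rw [mul_one, (isRotation_iff.mp hP).2.1]

lemma IsRotation.conj_mulVec {P : Mat3} (hP : IsRotation P) (A : Mat3) (v : Vec3) :
    (P * A * Pᵀ) *ᵥ (P *ᵥ v) = P *ᵥ (A *ᵥ v) := by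
  rw [← Matrix.mulVec_mulVec, hP.mulVec_cancel, Matrix.mulVec_mulVec]

lemma IsRotation.det_conj {P : Mat3} (hP : IsRotation P) (A : Mat3) :
    (P * A * Pᵀ).det = A.det := by
  rw [Matrix.det_mul, Matrix.det_mul, Matrix.det_transpose, (isRotation_iff.mp hP).2.2, mul_one,
    one_mul]

lemma IsRotation.inv_conj {P A : Mat3} (hP : IsRotation P) (hA : IsUnit A.det) :
    (P * A * Pᵀ)⁻¹ = P * A⁻¹ * Pᵀ := by
  apply Matrix.inv_eq_left_inv
  rw [hP.mul_conj, Matrix.nonsing_inv_mul _ hA, hP.one_conj]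

lemma IsRotation.cofactor_condition {P : Mat3} (hP : IsRotation P) {N : Mat3} {s m : Vec3}
    (h : (P *ᵥ s) ⬝ᵥ (((P * N * Pᵀ) * cofactorMatrix ((P * N * Pᵀ) ^ 2 - 1)) *ᵥ (P *ᵥ m)) = 0) :
    s ⬝ᵥ ((N * cofactorMatrix (N * N - 1)) *ᵥ m) = 0 := by
  have h1 : (P * N * Pᵀ) ^ 2 - 1 = P * (N * N - 1) * Pᵀ := by
    rw [sq, hP.mul_conj, Matrix.mul_sub, Matrix.sub_mul, hP.one_conj]
  rwa [h1, hP.cofactorMatrix_conj, hP.mul_conj, hP.conj_mulVec, hP.dotProduct_mulVec] at h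

lemma ShearData.conj {P : Mat3} (hP : IsRotation P) {N : Mat3} {s m p g : Vec3}
    (h : ShearData N s m p g) :
    ShearData (P * N * Pᵀ) (P *ᵥ s) (P *ᵥ m) (P *ᵥ p) (P *ᵥ g) := by
  have ht : ∀ u v : Vec3, 1 + tensor (P *ᵥ u) (P *ᵥ v) = P * (1 + tensor u v) * Pᵀ := by
    intro u v
    rw [Matrix.mul_add, Matrix.add_mul, hP.one_conj, mul_tensor, tensor_mul,
      Matrix.transpose_transpose]
  refine ⟨fun h0 => h.ne ?_, ?_, ?_, ?_, ?_⟩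
  · rw [← hP.mulVec_cancel p, h0, Matrix.mulVec_zero]
  · rw [hP.conj_mulVec, h.shear, Matrix.mulVec_smul]
  · rw [ht, ht, hP.mul_conj, hP.mul_conj, h.gram]
  · rw [hP.dotProduct_mulVec, hP.det_conj, h.dot]
  · rw [hP.dotProduct_mulVec, hP.det_conj, h.dot_axis]

/-- The shear vector of the twin with axis `m` in terms of `x = N⁻¹ m`. -/
lemma shear_conj {P N : Mat3} (hP : IsRotation P) (hN : IsUnit N.det) {m s x : Vec3}
    (hx : N *ᵥ x = m)
    (h : s = (2 : ℝ) • ((((P * N * Pᵀ)⁻¹ *ᵥ (P *ᵥ m)) ⬝ᵥ ((P * N * Pᵀ)⁻¹ *ᵥ (P *ᵥ m)))⁻¹ •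
      ((P * N * Pᵀ)⁻¹ *ᵥ (P *ᵥ m)) - (P * N * Pᵀ) *ᵥ (P *ᵥ m))) :
    s = P *ᵥ ((2 : ℝ) • ((x ⬝ᵥ x)⁻¹ • x - N *ᵥ m)) := by
  have hx' : N⁻¹ *ᵥ m = x := by
    rw [← hx, Matrix.mulVec_mulVec, Matrix.nonsing_inv_mul _ hN, Matrix.one_mulVec]
  rw [h, hP.inv_conj hN, hP.conj_mulVec, hP.conj_mulVec, hP.dotProduct_mulVec, hx',
    Matrix.mulVec_smul, Matrix.mulVec_sub, Matrix.mulVec_smul]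

/-! ### Shear and normals made explicit by the cofactor condition -/

lemma det_blockMatrix (a b c d : ℝ) : (blockMatrix a b c d).det = (a * c - b ^ 2) * d := by
  simp [blockMatrix, Matrix.det_fin_three]; ring

lemma blockMatrix_mulVec (a b c d x y z : ℝ) :
    blockMatrix a b c d *ᵥ ![x, y, z] = ![a * x + b * y, b * x + c * y, d * z] := by
  ext i; fin_cases i <;> simp [blockMatrix] <;> ring

lemma blockMatrix_mul_self_sub_one (a b c d : ℝ) :
    blockMatrix a b c d * blockMatrix a b c d - 1 =
      blockMatrix (a ^ 2 + b ^ 2 - 1) (b * (a + c)) (b ^ 2 + c ^ 2 - 1) (d ^ 2 - 1) := by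
  ext i j; fin_cases i <;> fin_cases j <;>
    simp [blockMatrix] <;> ring

lemma cofactorMatrix_blockMatrix (a b c d : ℝ) :
    cofactorMatrix (blockMatrix a b c d) = blockMatrix (c * d) (-(b * d)) (a * d)
      (a * c - b ^ 2) := by
  rw [cofactorMatrix, blockMatrix, Matrix.adjugate_fin_three_of]
  ext i j; fin_cases i <;> fin_cases j <;> simp [blockMatrix]
  ring

lemma vec3_dotProduct (x y z x' y' z' : ℝ) :
    (![x, y, z] : Vec3) ⬝ᵥ ![x', y', z'] = x * x' + y * y' + z * z' := by
  simp [dotProduct, Fin.sum_univ_three]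

lemma tensor_vec3 (x y z x' y' z' : ℝ) : tensor ![x, y, z] ![x', y', z'] =
    !![x * x', x * y', x * z'; y * x', y * y', y * z'; z * x', z * y', z * z'] := by
  ext i j; fin_cases i <;> fin_cases j <;> simp [tensor_apply]

/-- When the middle eigenvalue belongs to the monoclinic plane, with eigenvector `(1, -r, 0)`. -/
lemma shearData_of_ne_one {κ r d lam η : ℝ} {s x : Vec3} (hκ : κ ≠ 0) (hr : r ≠ 0) (hd : 0 < d)
    (hd1 : d ≠ 1) (hlam : lam = 1 + κ * (1 + r ^ 2)) (hlam0 : 0 < lam) (hη : 2 * η ^ 2 = 1)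
    (hx : x = ![-(η * (κ * r / lam)), η * (1 - κ / lam), η / d])
    (hs : s = (2 : ℝ) • ((x ⬝ᵥ x)⁻¹ • x - blockMatrix (1 + κ * r ^ 2) (κ * r) (1 + κ) d *ᵥ
      ![0, η, η]))
    (hc : s ⬝ᵥ ((blockMatrix (1 + κ * r ^ 2) (κ * r) (1 + κ) d *
      cofactorMatrix (blockMatrix (1 + κ * r ^ 2) (κ * r) (1 + κ) d *
        blockMatrix (1 + κ * r ^ 2) (κ * r) (1 + κ) d - 1)) *ᵥ ![0, η, η]) = 0) :
    lam ^ 2 * (1 - d ^ 2) = d ^ 2 * κ * (lam + 1) ∧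
    ∃ (p g : Vec3) (α β : ℝ), α ≠ 0 ∧ β ≠ 0 ∧
      ShearData (blockMatrix (1 + κ * r ^ 2) (κ * r) (1 + κ) d) s ![0, η, η] p g ∧
      p = α • ![r, 1, -1] ∧
      ∀ t, g + (t * (2 * (blockMatrix (1 + κ * r ^ 2) (κ * r) (1 + κ) d).det)) • ![0, η, η] =
        β • ![r, 1 - t * (1 + d / lam), d / lam - t * (1 + d / lam)] := by
  have hη0 : η ≠ 0 := by rintro rfl; norm_num at hη
  have hd21 : d ^ 2 - 1 ≠ 0 := by
    intro h0
    have : (d - 1) * (d + 1) = 0 := by linear_combination h0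
    rcases mul_eq_zero.mp this with h | h
    · exact hd1 (by linarith)
    · linarith
  have hdet : (blockMatrix (1 + κ * r ^ 2) (κ * r) (1 + κ) d).det = d * lam := by
    rw [det_blockMatrix, hlam]; ring
  -- With `x = U⁻¹ m`, the cofactor condition factors as `|x|⁻² - 1` times a nonzero quantity, hence
  -- `|U⁻¹ m| = 1`.
  have hν : x ⬝ᵥ x = 1 := by
    rw [blockMatrix_mul_self_sub_one, cofactorMatrix_blockMatrix, ← Matrix.mulVec_mulVec,
      blockMatrix_mulVec, blockMatrix_mulVec, hs, blockMatrix_mulVec] at hc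
    set ν := x ⬝ᵥ x
    rw [hx] at hc
    simp at hc
    have hfac : (ν⁻¹ - 1) * (κ * (lam + 1) * (d ^ 2 - 1) * r ^ 2) * (2 * η ^ 2) = 0 := by
      rw [← hc]
      field_simp
      rw [hlam]
      ring
    rw [hη, mul_one] at hfac
    have : ν⁻¹ - 1 = 0 := by
      refine (mul_eq_zero.mp hfac).resolve_right ?_
      have : lam + 1 ≠ 0 := by positivity
      positivity
    rw [← inv_inv ν, sub_eq_zero.mp this, inv_one]
  have hF : lam ^ 2 * (1 - d ^ 2) = d ^ 2 * κ * (lam + 1) := by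
    have h1 := hν
    rw [hx, vec3_dotProduct] at h1
    have h2 : (κ * r / lam) ^ 2 + (1 - κ / lam) ^ 2 + (1 / d) ^ 2 = 2 := by
      linear_combination 2 * h1 -
        ((κ * r / lam) ^ 2 + (1 - κ / lam) ^ 2 + (1 / d) ^ 2) * hη
    field_simp at h2
    linear_combination h2 + d ^ 2 * κ * hlam
  refine ⟨hF, ?_⟩
  have hld : lam + d ≠ 0 := by positivity
  -- The product of the scalars in `p` and `g`, so that `p ⊗ g = θ (r, 1, -1) ⊗ (r, 1, δ)`. The
  -- entries of the factorisation reduce to `K2` on the block, `K1'` off it, and `K3'` at the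
  -- corner.
  obtain ⟨θ, hθ⟩ : ∃ θ, θ = (1 - d ^ 2) * lam ^ 2 / (d * (lam + d)) := ⟨_, rfl⟩
  have hrel : lam ^ 2 * (1 - d ^ 2) * (1 + r ^ 2) = d ^ 2 * (lam ^ 2 - 1) := by
    rw [hF]
    have : κ * (1 + r ^ 2) = lam - 1 := by rw [hlam]; ring
    linear_combination d ^ 2 * (lam + 1) * this
  have hθ' : θ * d * (lam + d) = (1 - d ^ 2) * lam ^ 2 := by
    rw [hθ]; field_simp
  have K1 : θ * (r ^ 2 + 2) * d = lam - d := by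
    apply mul_right_cancel₀ hld
    linear_combination (r ^ 2 + 2) * hθ' + hrel
  have K2 : 2 * θ + θ ^ 2 * (r ^ 2 + 2) = κ * (lam + 1) := by
    have hd2 : d ^ 2 ≠ 0 := by positivity
    apply mul_left_cancel₀ hd2
    linear_combination hF + hθ' + θ * d * K1
  obtain ⟨δ, hδ⟩ : ∃ δ, δ = d / lam := ⟨_, rfl⟩
  have hδ' : δ * lam = d := by rw [hδ]; field_simp
  have K1' : θ * (r ^ 2 + 2) * δ = 1 - δ := by
    apply mul_right_cancel₀ hlam0.ne'
    linear_combination K1 + (θ * (r ^ 2 + 2) + 1) * hδ'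
  have K3 : θ * d * (1 + δ) = lam * (1 - d ^ 2) := by
    apply mul_right_cancel₀ hlam0.ne'
    linear_combination hθ' + θ * d * hδ'
  have K3' : θ * δ * (1 + δ) = 1 - d ^ 2 := by
    apply mul_right_cancel₀ hlam0.ne'
    linear_combination K3 + θ * (1 + δ) * hδ'
  refine ⟨(-(η * ((1 - d ^ 2) / d ^ 2))) • ![r, 1, -1],
    (-(2 * η * (d * lam ^ 2) / (lam + d))) • ![r, 1, d / lam],
    -(η * ((1 - d ^ 2) / d ^ 2)), -(2 * η * (d * lam ^ 2) / (lam + d)), ?_, ?_, ?_, rfl, ?_⟩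
  · have : 1 - d ^ 2 ≠ 0 := fun h0 => hd21 (by linarith)
    exact neg_ne_zero.mpr (mul_ne_zero hη0 (div_ne_zero this (by positivity)))
  · exact neg_ne_zero.mpr (by positivity)
  · have hprod : -(η * ((1 - d ^ 2) / d ^ 2)) * -(2 * η * (d * lam ^ 2) / (lam + d)) = θ := by
      rw [hθ]
      field_simp
      linear_combination (1 - d ^ 2) * hη
    have hprod' : -(2 * η * (d * lam ^ 2) / (lam + d)) * -(η * ((1 - d ^ 2) / d ^ 2)) = θ := by
      rw [mul_comm, hprod]
    have hn : -(η * ((1 - d ^ 2) / d ^ 2)) ≠ 0 := by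
      have : 1 - d ^ 2 ≠ 0 := fun h0 => hd21 (by linarith)
      exact neg_ne_zero.mpr (mul_ne_zero hη0 (div_ne_zero this (by positivity)))
    refine ⟨?_, ?_, ?_, ?_, ?_⟩
    · exact smul_ne_zero hn (fun h0 => hr (by simpa using congrFun h0 0))
    · rw [hs, hν, inv_one, one_smul, hx, Matrix.mulVec_smul, blockMatrix_mulVec,
        blockMatrix_mulVec]
      congr 1
      ext i; fin_cases i <;> simp <;> field_simp
      · linear_combination hF - lam * (1 - d ^ 2) * hlam
      · linear_combination hF - lam * (1 - d ^ 2) * hlam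
    · rw [tensor_smul, smul_tensor, tensor_smul, smul_tensor, smul_smul, smul_smul, hprod, hprod',
        tensor_vec3, tensor_vec3, ← hδ]
      ext i j
      fin_cases i <;> fin_cases j <;> simp [blockMatrix, Matrix.one_fin_three]
      · linear_combination r ^ 2 * (K2 + κ * hlam)
      · linear_combination r * (K2 + κ * hlam)
      · linear_combination r * θ * K1'
      · linear_combination r * (K2 + κ * hlam)
      · linear_combination K2 + κ * hlam
      · linear_combination θ * K1'
      · linear_combination r * θ * K1'
      · linear_combination θ * K1'
      · linear_combination θ * δ * K1' - K3'
    · rw [hdet, smul_dotProduct, dotProduct_smul, smul_smul, hprod, vec3_dotProduct, ← hδ,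
        smul_eq_mul]
      apply mul_left_cancel₀ hd.ne'
      linear_combination K1 - K3
    · rw [hdet, smul_dotProduct, vec3_dotProduct, smul_eq_mul]
      field_simp
      linear_combination -(lam + d) * hη
  · intro t
    rw [hdet]
    ext i; fin_cases i <;> simp
    · field_simp; ring
    · field_simp; ring

/-- When the middle eigenvalue belongs to the monoclinic axis. -/
lemma shearData_of_eq_one {a b c D η : ℝ} {s x : Vec3} (hb : b ≠ 0) (hac : 0 < a + c)
    (hD : D = a * c - b ^ 2) (hD0 : 0 < D) (hne : (a - 1) * (c - 1) ≠ b ^ 2)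
    (hη : 2 * η ^ 2 = 1)
    (hx : x = ![-(η * (b / D)), η * (a / D), η])
    (hs : s = (2 : ℝ) • ((x ⬝ᵥ x)⁻¹ • x - blockMatrix a b c 1 *ᵥ ![0, η, η]))
    (hc : s ⬝ᵥ ((blockMatrix a b c 1 * cofactorMatrix (blockMatrix a b c 1 *
      blockMatrix a b c 1 - 1)) *ᵥ ![0, η, η]) = 0) :
    a ^ 2 + b ^ 2 = D ^ 2 ∧
    ∃ (p g : Vec3) (α β : ℝ), α ≠ 0 ∧ β ≠ 0 ∧
      ShearData (blockMatrix a b c 1) s ![0, η, η] p g ∧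
      p = α • ![1, 0, 0] ∧
      ∀ t, g + (t * (2 * (blockMatrix a b c 1).det)) • ![0, η, η] =
        β • ![D * (D - 1) / (b * (a + c)), 1 - t, -t] := by
  have hη0 : η ≠ 0 := by rintro rfl; norm_num at hη
  have hdet : (blockMatrix a b c 1).det = D := by
    rw [det_blockMatrix, hD]; ring
  have hν : x ⬝ᵥ x = 1 := by
    rw [blockMatrix_mul_self_sub_one, cofactorMatrix_blockMatrix, ← Matrix.mulVec_mulVec,
      blockMatrix_mulVec, blockMatrix_mulVec, hs, blockMatrix_mulVec] at hc
    set ν := x ⬝ᵥ x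
    rw [hx] at hc
    simp at hc
    have hfac : (ν⁻¹ - 1) * ((1 - (a + c) + D) * (1 + (a + c) + D)) * (2 * η ^ 2) = 0 := by
      rw [hD]
      rcases hc with hc | hc
      · linear_combination (2 * η * ((1 - (a + c) + (a * c - b ^ 2)) * (1 + (a + c) +
          (a * c - b ^ 2)))) * hc
      · have hc := hc.resolve_right hη0
        linear_combination (ν⁻¹ - 1) * (2 * η ^ 2) * hc
    rw [hη, mul_one] at hfac
    have : ν⁻¹ - 1 = 0 := by
      -- The first factor is `(a - 1)(c - 1) - b²`, nonzero because the eigenvalue `1` on the axis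
      -- is simple.
      refine (mul_eq_zero.mp hfac).resolve_right (mul_ne_zero (fun h0 => hne ?_) (by positivity))
      rw [hD] at h0
      linear_combination h0
    rw [← inv_inv ν, sub_eq_zero.mp this, inv_one]
  have hF : a ^ 2 + b ^ 2 = D ^ 2 := by
    have h1 := hν
    rw [hx, vec3_dotProduct] at h1
    have h2 : (b / D) ^ 2 + (a / D) ^ 2 = 1 := by
      linear_combination 2 * h1 - ((b / D) ^ 2 + (a / D) ^ 2 + 1) * hη
    field_simp at h2
    linear_combination h2
  refine ⟨hF, ?_⟩
  have hG : D ^ 2 * (b ^ 2 + c ^ 2 - 1) = b ^ 2 * (a + c) ^ 2 := by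
    rw [← hF]
    -- The determinant of the squared block is `D²`.
    have : (a ^ 2 + b ^ 2) * (b ^ 2 + c ^ 2) = D ^ 2 + b ^ 2 * (a + c) ^ 2 := by rw [hD]; ring
    linear_combination this - hF
  refine ⟨(-(η * (b * (a + c) / D ^ 2))) • ![1, 0, 0],
    (-(2 * η * D)) • ![D * (D - 1) / (b * (a + c)), 1, 0],
    -(η * (b * (a + c) / D ^ 2)), -(2 * η * D), ?_, ?_, ?_, rfl, ?_⟩
  · exact neg_ne_zero.mpr (by positivity)
  · exact neg_ne_zero.mpr (by positivity)
  · refine ⟨?_, ?_, ?_, ?_, ?_⟩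
    · exact smul_ne_zero (neg_ne_zero.mpr (by positivity))
        (fun h0 => one_ne_zero (α := ℝ) (by simpa using congrFun h0 0))
    · rw [hs, hν, inv_one, one_smul, hx, Matrix.mulVec_smul, blockMatrix_mulVec,
        blockMatrix_mulVec]
      congr 1
      ext i; fin_cases i <;> simp <;> field_simp
      · linear_combination hF - hD
      · linear_combination c * hF + a * hD
    · have hprod : -(η * (b * (a + c) / D ^ 2)) * -(2 * η * D) = b * (a + c) / D := by
        field_simp
        linear_combination hη
      have hprod' : -(2 * η * D) * -(η * (b * (a + c) / D ^ 2)) = b * (a + c) / D := by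
        rw [mul_comm, hprod]
      rw [tensor_smul, smul_tensor, tensor_smul, smul_tensor, smul_smul, smul_smul, hprod, hprod',
        tensor_vec3, tensor_vec3]
      have q1 : b * (a + c) / D * (D * (D - 1) / (b * (a + c))) = D - 1 := by field_simp
      have q2 : D * (b * (a + c) / D) = b * (a + c) := by field_simp
      have q3 : b * (a + c) / D * (b * (a + c) / D) = b ^ 2 + c ^ 2 - 1 := by
        field_simp
        linear_combination -hG
      ext i j
      fin_cases i <;> fin_cases j <;> simp [blockMatrix, Matrix.one_fin_three, q1]
      · linear_combination -hF
      · linear_combination q2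
      · linear_combination q2
      · linear_combination q3
    · rw [hdet, smul_dotProduct, dotProduct_smul, vec3_dotProduct, smul_eq_mul, smul_eq_mul]
      field_simp
      linear_combination D * (D - 1) * hη
    · rw [hdet, smul_dotProduct, vec3_dotProduct, smul_eq_mul]
      linear_combination (-D) * hη
  · intro t
    rw [hdet]
    ext i; fin_cases i <;> simp
    · ring
    · ring

/-! ### The criteria in terms of the eigenvalues -/

lemma IsOrderedSpectrum.coefficients {a b c d l₁ l₃ : ℝ}
    (h : IsOrderedSpectrum (cubicMonoclinic a b c d 0) l₁ 1 l₃) :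
    l₁ ≤ 1 ∧ 1 ≤ l₃ ∧ a + c + d = l₁ + 1 + l₃ ∧
      (a * c - b ^ 2) + d * (a + c) = l₁ + l₃ + l₁ * l₃ ∧ d * (a * c - b ^ 2) = l₁ * l₃ := by
  obtain ⟨h1, h2, h3⟩ := h
  have key : ∀ x : ℝ, (x - d) * ((x - a) * (x - c) - b ^ 2) = (x - l₁) * (x - 1) * (x - l₃) := by
    intro x
    have := congrArg (Polynomial.eval x) h3
    have hsub : Matrix.scalar (Fin 3) x - cubicMonoclinic a b c d 0 =
        !![x - a, -b, 0; -b, x - c, 0; 0, 0, x - d] := by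
      ext i j; fin_cases i <;> fin_cases j <;> simp [cubicMonoclinic]
    rw [Matrix.eval_charpoly, hsub] at this
    simp [Matrix.det_fin_three] at this
    linear_combination this
  -- Two monic cubics are compared, so three values determine the coefficients.
  have k0 := key 0
  have k1 := key 1
  have k2 := key (-1)
  refine ⟨h1, h2, ?_, ?_, ?_⟩ <;> linarith

lemma hasStarFamily_iff_isOrbitFamily {a b c d a' b' c' η α β : ℝ}
    (hne : (a - d) * (c - d) ≠ b ^ 2) {i j : Fin 12} {R P : Mat3} {s s' m p g u : Vec3}
    {n : ℝ → Vec3}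
    (htwin : IsTypeITwin (cubicMonoclinic a b c d i) (cubicMonoclinic a b c d j) R s m)
    (hcof : CofactorConditions (cubicMonoclinic a b c d i) s m) (hP : IsCubicRotation P)
    (hη : 2 * η ^ 2 = 1) (hU : cubicMonoclinic a b c d i = P * blockMatrix a' b' c' d * Pᵀ)
    (hm : m = P *ᵥ ![0, η, η]) (hs : s = P *ᵥ s')
    (hS : ShearData (blockMatrix a' b' c' d) s' ![0, η, η] p g) (hα : α ≠ 0) (hβ : β ≠ 0)
    (hp : p = α • u)
    (hn : ∀ t, g + (t * (2 * (blockMatrix a' b' c' d).det)) • ![0, η, η] = β • n t) (k : ℕ) :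
    HasStarFamily k (Set.range (cubicMonoclinic a b c d)) (cubicMonoclinic a b c d i)
      (cubicMonoclinic a b c d j) R s m ↔
      ∃ t : ℝ, 0 < t ∧ t < 1 ∧ ∃ Q : Fin k → Mat3, IsOrbitFamily u (n t) Q := by
  have hS' : ShearData (cubicMonoclinic a b c d i) s m (P *ᵥ p) (P *ᵥ g) := by
    rw [hU, hm, hs]; exact hS.conj hP.1
  have hNz : blockMatrix a' b' c' d *ᵥ Pi.single 2 1 = d • Pi.single 2 1 := by
    ext i; fin_cases i <;> simp [blockMatrix]
  have hUz : cubicMonoclinic a b c d i *ᵥ (P *ᵥ Pi.single 2 1) = d • (P *ᵥ Pi.single 2 1) := by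
    rw [hU, hP.1.conj_mulVec, hNz, Matrix.mulVec_smul]
  have hVy : cubicMonoclinic a b c d j *ᵥ (P *ᵥ Pi.single 1 1) =
      d • (P *ᵥ Pi.single 1 1) := by
    have hax := htwin.axis
    rw [hU, hm] at hax
    exact hax.mulVec_second hP.1 hη
  have hvec : ∀ μ : ℝ, μ • (P *ᵥ g) + (1 - μ) • (P *ᵥ g +
      (2 * (cubicMonoclinic a b c d i).det) • m) = P *ᵥ (β • n (1 - μ)) := by
    intro μ
    rw [← hn, hU, hP.1.det_conj, hm, Matrix.mulVec_add, Matrix.mulVec_smul]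
    module
  have key : ∀ μ : ℝ, (∃ Q : Fin k → Mat3,
      IsStarFamily (Set.range (cubicMonoclinic a b c d)) (cubicMonoclinic a b c d i)
        (cubicMonoclinic a b c d j) (P *ᵥ p) (P *ᵥ g)
        (P *ᵥ g + (2 * (cubicMonoclinic a b c d i).det) • m) μ Q) ↔
      ∃ Q : Fin k → Mat3, IsOrbitFamily u (n (1 - μ)) Q := by
    intro μ
    simp only [isStarFamily_iff hne (Set.mem_range_self i) (Set.mem_range_self j) hP
      (show (2 : Fin 3) ≠ 1 by decide) hUz hVy, hvec]
    rw [exists_isOrbitFamily_conj hP, hp]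
    simp only [isOrbitFamily_smul_iff hα hβ]
  rw [hasStarFamily_iff (Set.mem_range_self i) (Set.mem_range_self j) htwin hcof hS' k]
  -- The weight of the second normal is `t = 1 - μ`.
  constructor
  · rintro ⟨μ, h0, h1, h⟩
    exact ⟨1 - μ, by linarith, by linarith, (key μ).mp h⟩
  · rintro ⟨t, h0, h1, h⟩
    refine ⟨1 - t, by linarith, by linarith, (key (1 - t)).mpr ?_⟩
    rwa [sub_sub_cancel]

/-- The two families when the middle eigenvalue belongs to the monoclinic plane. -/
lemma hasStarFamily_iff_of_ne_one {a b c d lam : ℝ} (hb : b ≠ 0) (hd : 0 < d) (hd1 : d ≠ 1)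
    (hlam0 : 0 < lam) (htr : a + c = 1 + lam) (hdet : a * c - b ^ 2 = lam) {i j : Fin 12}
    {R : Mat3} {s m : Vec3}
    (htwin : IsTypeITwin (cubicMonoclinic a b c d i) (cubicMonoclinic a b c d j) R s m)
    (hcof : CofactorConditions (cubicMonoclinic a b c d i) s m) :
    (HasStarFamily 3 (Set.range (cubicMonoclinic a b c d)) (cubicMonoclinic a b c d i)
      (cubicMonoclinic a b c d j) R s m ↔
        a ≠ c ∧ 2 * d ^ 2 * lam ^ 2 - lam ^ 2 - d ^ 2 = (d - lam) ^ 2 * (1 - d ^ 2)) ∧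
    ((HasStarFamily 2 (Set.range (cubicMonoclinic a b c d)) (cubicMonoclinic a b c d i)
        (cubicMonoclinic a b c d j) R s m ∧
      ¬ HasStarFamily 3 (Set.range (cubicMonoclinic a b c d)) (cubicMonoclinic a b c d i)
        (cubicMonoclinic a b c d j) R s m) ↔
        4 * (2 * d ^ 2 * lam ^ 2 - lam ^ 2 - d ^ 2) = (d - lam) ^ 2 * (1 - d ^ 2) ∧
          ¬ (5 * lam ^ 2 = 1 ∧ d = 5 * lam)) := by
  have hne := htwin.isUniqueTwinAxis.simple_eigenvalue hb
  obtain ⟨P, a', b', c', η, hP, hb', hac', hη, hU, hm⟩ :=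
    exists_normal_form hne htwin.isUniqueTwinAxis
  have htr' : a' + c' = 1 + lam := by
    rcases hac' with ⟨rfl, rfl⟩ | ⟨rfl, rfl⟩ <;> linarith
  have hdet' : a' * c' - b' ^ 2 = lam := by
    rcases hac' with ⟨rfl, rfl⟩ | ⟨rfl, rfl⟩ <;> linarith
  have hac'' : a ≠ c ↔ a' ≠ c' := by
    rcases hac' with ⟨rfl, rfl⟩ | ⟨rfl, rfl⟩
    · rfl
    · exact ne_comm
  have hb'0 : b' ≠ 0 := by
    rintro rfl
    exact hb (pow_eq_zero_iff two_ne_zero |>.mp (by rw [← hb']; norm_num))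
  -- The block has the eigenvalue `1`, so block minus identity has rank one and equals `κ (r, 1) ⊗
  -- (r, 1)`.
  obtain ⟨κ, hκ⟩ : ∃ κ, κ = c' - 1 := ⟨_, rfl⟩
  have hplane : (a' - 1) * κ = b' ^ 2 := by rw [hκ]; linear_combination hdet' - htr'
  have hκ0 : κ ≠ 0 := by
    intro h0; rw [h0, mul_zero] at hplane
    exact hb'0 (pow_eq_zero_iff two_ne_zero |>.mp hplane.symm)
  obtain ⟨r, hr⟩ : ∃ r, r = b' / κ := ⟨_, rfl⟩
  have hr0 : r ≠ 0 := by rw [hr]; exact div_ne_zero hb'0 hκ0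
  obtain rfl : b' = κ * r := by rw [hr]; field_simp
  obtain rfl : c' = 1 + κ := by rw [hκ]; ring
  obtain rfl : a' = 1 + κ * r ^ 2 := by
    apply mul_right_cancel₀ hκ0
    linear_combination hplane
  have hlam : lam = 1 + κ * (1 + r ^ 2) := by linear_combination -htr'
  have hNdet : IsUnit (blockMatrix (1 + κ * r ^ 2) (κ * r) (1 + κ) d).det := by
    rw [det_blockMatrix, hdet']
    exact (mul_pos hlam0 hd).ne'.isUnit
  have hx : blockMatrix (1 + κ * r ^ 2) (κ * r) (1 + κ) d *ᵥ
      ![-(η * (κ * r / lam)), η * (1 - κ / lam), η / d] = ![0, η, η] := by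
    rw [blockMatrix_mulVec]
    ext i; fin_cases i <;> simp <;> field_simp <;> rw [hlam] <;> ring
  have hs := htwin.shear
  have hc := hcof.cc2
  rw [hU, hm] at hs
  have hs := shear_conj hP.1 hNdet hx hs
  rw [hU, hm, hs] at hc
  obtain ⟨hF, p, g, α, β, hα, hβ, hS, hp, hn⟩ := shearData_of_ne_one hκ0 hr0 hd hd1 hlam hlam0 hη
    rfl rfl (hP.1.cofactor_condition hc)
  have hiff := hasStarFamily_iff_isOrbitFamily hne htwin hcof hP hη hU hm hs hS hα hβ hp hn
  have hδ0 : 0 < d / lam := div_pos hd hlam0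
  have hdlam : d ≠ lam := by
    rintro rfl
    apply hne
    linear_combination hdet - d * htr
  have hδ1 : d / lam ≠ 1 := by rwa [Ne, div_eq_one_iff_eq hlam0.ne']
  have h3 := (hiff 3).trans (exists_isOrbitFamily_three_iff hδ0 hδ1 hr0)
  have h2 := (hiff 2).trans (exists_isOrbitFamily_two_iff hδ0 hδ1 hr0)
  have hrel : lam ^ 2 * (1 - d ^ 2) * r ^ 2 = 2 * d ^ 2 * lam ^ 2 - lam ^ 2 - d ^ 2 := by
    linear_combination (1 + r ^ 2) * hF - d ^ 2 * (lam + 1) * hlam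
  have hd2 : 1 - d ^ 2 ≠ 0 := by
    intro h0
    have : (d - 1) * (d + 1) = 0 := by linear_combination -h0
    rcases mul_eq_zero.mp this with h | h
    · exact hd1 (by linarith)
    · linarith
  have hK : lam ^ 2 * (1 - d ^ 2) ≠ 0 := mul_ne_zero (by positivity) hd2
  have hδ : lam ^ 2 * (1 - d ^ 2) * (1 - d / lam) ^ 2 = (d - lam) ^ 2 * (1 - d ^ 2) := by
    field_simp; ring
  have e1 : r ^ 2 = (1 - d / lam) ^ 2 ↔
      2 * d ^ 2 * lam ^ 2 - lam ^ 2 - d ^ 2 = (d - lam) ^ 2 * (1 - d ^ 2) := by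
    rw [← hrel, ← hδ, mul_right_inj' hK]
  have e2 : 4 * r ^ 2 = (1 - d / lam) ^ 2 ↔
      4 * (2 * d ^ 2 * lam ^ 2 - lam ^ 2 - d ^ 2) = (d - lam) ^ 2 * (1 - d ^ 2) := by
    rw [← hrel, ← hδ, mul_left_comm, mul_right_inj' hK]
  -- The diagonal entries of the block are `1 + κ r²` and `1 + κ`.
  have e3 : r ^ 2 ≠ 1 ↔ a ≠ c := by
    rw [hac'', not_iff_not]
    constructor
    · intro h; rw [h, mul_one]
    · intro h
      apply mul_left_cancel₀ hκ0
      linarith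
  refine ⟨h3.trans (by rw [e1, e3, and_comm]), ?_⟩
  rw [h2, h3, ← e2]
  constructor
  · rintro ⟨h | ⟨h4, h5⟩, h6⟩
    · exact absurd h h6
    · refine ⟨h4, fun h7 => h5 ?_⟩
      rw [h7.2]; field_simp
  · rintro ⟨h4, h5⟩
    have h6 : d / lam ≠ 5 := by
      intro h6
      have h7 : d = 5 * lam := by rw [div_eq_iff hlam0.ne'] at h6; exact h6
      refine h5 ⟨?_, h7⟩
      -- If `δ = 5`, the equation gives `r² = 4`, and the formula for `r²` then forces `5 λ² = 1`:
      -- the excluded pair.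
      have h8 : r ^ 2 = 4 := by rw [h6] at h4; linarith
      rw [h8, h7] at hrel
      have : lam ^ 2 * (5 * lam ^ 2 - 1) = 0 := by linear_combination (-1 / 30) * hrel
      have := (mul_eq_zero.mp this).resolve_left (by positivity)
      linarith
    -- The conditions for two and for three rotations together would give `r = 0`.
    refine ⟨.inr ⟨h4, h6⟩, fun ⟨h7, _⟩ => hr0 ?_⟩
    have : r ^ 2 = 0 := by linarith
    exact pow_eq_zero_iff two_ne_zero |>.mp this

/-- The two families when the middle eigenvalue belongs to the monoclinic axis. -/
lemma hasStarFamily_iff_of_eq_one {a b c D : ℝ} (hb : b ≠ 0) (hac : 0 < a + c) (hD0 : 0 < D)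
    (hD : D = a * c - b ^ 2) {i j : Fin 12} {R : Mat3} {s m : Vec3}
    (htwin : IsTypeITwin (cubicMonoclinic a b c 1 i) (cubicMonoclinic a b c 1 j) R s m)
    (hcof : CofactorConditions (cubicMonoclinic a b c 1 i) s m) :
    ¬ HasStarFamily 3 (Set.range (cubicMonoclinic a b c 1)) (cubicMonoclinic a b c 1 i)
      (cubicMonoclinic a b c 1 j) R s m ∧
    (HasStarFamily 2 (Set.range (cubicMonoclinic a b c 1)) (cubicMonoclinic a b c 1 i)
      (cubicMonoclinic a b c 1 j) R s m ↔
        4 * (D - 1) ^ 2 = (a + c) ^ 2 - 2 * D - D ^ 2 - 1) := by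
  have hne := htwin.isUniqueTwinAxis.simple_eigenvalue hb
  obtain ⟨P, a', b', c', η, hP, hb', hac', hη, hU, hm⟩ :=
    exists_normal_form hne htwin.isUniqueTwinAxis
  have htr : a + c = a' + c' := by
    rcases hac' with ⟨rfl, rfl⟩ | ⟨rfl, rfl⟩ <;> ring
  have hdet : D = a' * c' - b' ^ 2 := by
    rcases hac' with ⟨rfl, rfl⟩ | ⟨rfl, rfl⟩ <;> linarith
  have hne' : (a' - 1) * (c' - 1) ≠ b' ^ 2 := by
    intro h0; apply hne; linear_combination h0 - hD + hdet - htr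
  have hb'0 : b' ≠ 0 := by
    rintro rfl
    exact hb (pow_eq_zero_iff two_ne_zero |>.mp (by rw [← hb']; norm_num))
  have hac'0 : 0 < a' + c' := by rwa [← htr]
  have hNdet : IsUnit (blockMatrix a' b' c' 1).det := by
    rw [det_blockMatrix, ← hdet, mul_one]
    exact hD0.ne'.isUnit
  have hx : blockMatrix a' b' c' 1 *ᵥ ![-(η * (b' / D)), η * (a' / D), η] = ![0, η, η] := by
    rw [blockMatrix_mulVec]
    ext i; fin_cases i <;> simp <;> field_simp
    · ring
    · linear_combination -η * hdet
  have hs := htwin.shear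
  have hc := hcof.cc2
  rw [hU, hm] at hs
  have hs := shear_conj hP.1 hNdet hx hs
  rw [hU, hm, hs] at hc
  obtain ⟨hF, p, g, α, β, hα, hβ, hS, hp, hn⟩ := shearData_of_eq_one hb'0 hac'0 hdet hD0 hne' hη
    rfl rfl (hP.1.cofactor_condition hc)
  have hiff := hasStarFamily_iff_isOrbitFamily hne htwin hcof hP hη hU hm hs hS hα hβ hp hn
  refine ⟨?_, ?_⟩
  · rw [hiff 3]
    rintro ⟨t, ht0, ht1, Q, hQ⟩
    exact not_isOrbitFamily_three_of_axis ht0 ht1 hQ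
  · rw [hiff 2, exists_isOrbitFamily_two_iff_of_axis, htr]
    have hG : b' ^ 2 * (a' + c') ^ 2 = D ^ 2 * ((a' + c') ^ 2 - 2 * D - D ^ 2 - 1) := by
      have : (a' ^ 2 + b' ^ 2) * (b' ^ 2 + c' ^ 2) = D ^ 2 + b' ^ 2 * (a' + c') ^ 2 := by
        rw [hdet]; ring
      have h2 : b' ^ 2 + c' ^ 2 = (a' + c') ^ 2 - 2 * D - D ^ 2 := by
        linear_combination 2 * hdet - hF
      rw [hF, h2] at this
      linear_combination -this
    have hpos : b' ^ 2 * (a' + c') ^ 2 ≠ 0 := by positivity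
    rw [div_pow, ← mul_div_assoc, mul_pow b', div_eq_one_iff_eq hpos, hG, mul_pow, mul_left_comm,
      mul_right_inj' (by positivity)]

theorem mainTheorem2 (a b c d : ℝ) (ha : 0 < a) (hb : 0 < b) (hc : 0 < c) (hd : 0 < d)
    (hpos : ∀ k, (cubicMonoclinic a b c d k).PosDef)
    (i j : Fin 12) (hij : i ≠ j) (R : Mat3) (s m : Vec3)
    (htwin : IsTypeITwin (cubicMonoclinic a b c d i) (cubicMonoclinic a b c d j) R s m)
    (hcof : CofactorConditions (cubicMonoclinic a b c d i) s m)
    (l₁ l₃ : ℝ) (hspec : IsOrderedSpectrum (cubicMonoclinic a b c d 0) l₁ 1 l₃) :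
    (IsTypeIHalfStarTwin (Set.range (cubicMonoclinic a b c d))
        (cubicMonoclinic a b c d i) (cubicMonoclinic a b c d j) R s m ↔
      (d ≠ 1 ∧ d = l₁ ∧
        4 * (2 * d ^ 2 * l₃ ^ 2 - l₃ ^ 2 - d ^ 2) = (d - l₃) ^ 2 * (1 - d ^ 2)) ∨
      (d ≠ 1 ∧ d = l₃ ∧ ¬ (d = Real.sqrt 5 ∧ l₁ = 1 / Real.sqrt 5) ∧
        4 * (2 * d ^ 2 * l₁ ^ 2 - l₁ ^ 2 - d ^ 2) = (d - l₁) ^ 2 * (1 - d ^ 2)) ∨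
      (d = 1 ∧ 1 < l₃ ∧
        l₁ ^ 2 * (5 * l₃ ^ 2 - 1) = 8 * l₁ * l₃ - 5 + l₃ ^ 2)) ∧
    (IsTypeIStarTwin (Set.range (cubicMonoclinic a b c d))
        (cubicMonoclinic a b c d i) (cubicMonoclinic a b c d j) R s m ↔
      a ≠ c ∧
        ((d ≠ 1 ∧ d = l₁ ∧
          2 * d ^ 2 * l₃ ^ 2 - l₃ ^ 2 - d ^ 2 = (d - l₃) ^ 2 * (1 - d ^ 2)) ∨
        (d ≠ 1 ∧ d = l₃ ∧
          2 * d ^ 2 * l₁ ^ 2 - l₁ ^ 2 - d ^ 2 = (d - l₁) ^ 2 * (1 - d ^ 2)))) := by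
  obtain ⟨hl1, hl3, t1, t2, t3⟩ := hspec.coefficients
  have hD0 : 0 < a * c - b ^ 2 := by
    have h0 := (hpos 0).det_pos
    have : (cubicMonoclinic a b c d 0).det = (a * c - b ^ 2) * d := det_blockMatrix a b c d
    rw [this] at h0
    exact pos_of_mul_pos_left h0 hd.le
  unfold IsTypeIHalfStarTwin IsTypeIStarTwin
  by_cases hd1 : d = 1
  · subst hd1
    obtain ⟨h3, h2⟩ := hasStarFamily_iff_of_eq_one hb.ne' (by linarith) hD0 rfl htwin hcof
    have hne := htwin.isUniqueTwinAxis.simple_eigenvalue hb.ne'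
    have hl3' : 1 < l₃ := by
      -- If `l₃ = 1`, the eigenvalue `d = 1` would be multiple.
      refine lt_of_le_of_ne hl3 (fun h0 => hne ?_)
      rw [← h0] at t1 t3
      linear_combination t3 - t1
    refine ⟨?_, iff_of_false h3 (by simp)⟩
    rw [h2]
    have e1 : a * c - b ^ 2 = l₁ * l₃ := by linarith
    have e2 : a + c = l₁ + l₃ := by linarith
    rw [e1, e2]
    constructor
    · rintro ⟨h, -⟩
      exact .inr (.inr ⟨rfl, hl3', by linear_combination h⟩)
    · rintro (⟨h, -⟩ | ⟨h, -⟩ | ⟨-, -, h⟩)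
      · exact absurd rfl h
      · exact absurd rfl h
      · exact ⟨by linear_combination h, h3⟩
  -- The number `d` is a root of the characteristic polynomial different from `1`; the block then
  -- has the eigenvalues `1` and the remaining one.
  · have hroot : (d - l₁) * (d - l₃) = 0 := by
      have : (d - 1) * ((d - l₁) * (d - l₃)) = 0 := by
        linear_combination d ^ 2 * t1 - d * t2 + t3
      exact (mul_eq_zero.mp this).resolve_left (sub_ne_zero.mpr hd1)
    rcases mul_eq_zero.mp hroot with hdl | hdl
    · have hdl : d = l₁ := by linarith
      have hlt : d < l₃ := by
        rcases lt_or_eq_of_le hl1 with h | h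
        · linarith
        · exact absurd (hdl.trans h) hd1
      have hD : a * c - b ^ 2 = l₃ := by
        apply mul_left_cancel₀ hd.ne'
        rw [t3, hdl]
      obtain ⟨h3, h2⟩ := hasStarFamily_iff_of_ne_one hb.ne' hd hd1 (by linarith)
        (by linarith) hD htwin hcof
      rw [h2, h3]
      -- The exceptional pair has `d` larger than the other eigenvalue, so it cannot occur when `d`
      -- is the smallest.
      have hex : ¬ (5 * l₃ ^ 2 = 1 ∧ d = 5 * l₃) := fun h => by linarith [h.2]
      have hdl3 : d ≠ l₃ := hlt.ne
      simp only [hex, hd1, hdl3, ne_eq, not_false_eq_true, true_and, and_true, false_and, and_false,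
        or_false, ← hdl]
    · have hdl : d = l₃ := by linarith
      have hlt : l₁ < d := by
        rcases lt_or_eq_of_le hl3 with h | h
        · linarith
        · exact absurd (hdl.trans h.symm) hd1
      have hD : a * c - b ^ 2 = l₁ := by
        apply mul_left_cancel₀ hd.ne'
        rw [t3, hdl, mul_comm]
      obtain ⟨h3, h2⟩ := hasStarFamily_iff_of_ne_one hb.ne' hd hd1 (by linarith)
        (by linarith) hD htwin hcof
      rw [h2, h3]
      have hl0 : 0 < l₁ := by linarith
      have h5 : Real.sqrt 5 * Real.sqrt 5 = 5 := Real.mul_self_sqrt (by norm_num)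
      have h50 : 0 < Real.sqrt 5 := by positivity
      have hex : (5 * l₁ ^ 2 = 1 ∧ d = 5 * l₁) ↔ (d = Real.sqrt 5 ∧ l₁ = 1 / Real.sqrt 5) := by
        constructor
        · rintro ⟨e1, e2⟩
          have e3 : d = Real.sqrt 5 := by
            rw [eq_comm, Real.sqrt_eq_iff_mul_self_eq (by norm_num) hd.le, e2]
            linear_combination -5 * e1
          refine ⟨e3, ?_⟩
          rw [eq_div_iff h50.ne', ← e3, e2]
          linear_combination e1
        · rintro ⟨e1, e2⟩
          have e3 : l₁ * Real.sqrt 5 = 1 := by rw [e2]; field_simp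
          refine ⟨?_, ?_⟩
          · linear_combination (l₁ * Real.sqrt 5 + 1) * e3 - l₁ ^ 2 * h5
          · rw [e1]; linear_combination -Real.sqrt 5 * e3 + l₁ * h5
      have hdl1 : d ≠ l₁ := hlt.ne'
      rw [hex]
      simp only [hd1, hdl1, ne_eq, not_false_eq_true, true_and, false_and, and_false, or_false,
        false_or, ← hdl]
      exact ⟨and_comm, trivial⟩
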